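/- Let $\{(X_i,Y_i)\}_{i\ge 1}$ be a stochastic process over a finite alphabet $\mathcal X\times\mathcal Y$, let $\rho>0$, let $\log$ denote $\log_2$, and put $\tilde\rho=1/(1+\rho)$. For a pair $(X,Y)$ with joint PMF $P$ on a finite set, let $$H_{\tilde\rho}(X|Y)=\frac{\tilde\rho}{1-\tilde\rho}\log\sum_{y}\Bigl(\sum_{x}P(x,y)^{\tilde\rho}\Bigr)^{1/\tilde\rho},$$ and suppose that the limit $H=\lim_{n\to\infty}H_{\tilde\rho}(X^n|Y^n)/n$ exists, where $(X^n,Y^n)$ consists of the first $n$ pairs. Fix integers $0\le\eta<\nu\le\delta$ and a per-hint storage rate $R_s\ge 0$. At blocklength $n$, a stochastic encoder observes $(X^n,Y^n)$ and draws hints $M=(M_1,\dots,M_\delta)$, each of $s=\lfloor nR_s\rfloor$ bits (so each takes values in a set of size $2^s$), according to a conditional PMF given $(X^n,Y^n)$. A guessing function on $\mathcal X^n$ is a bijection $G:\mathcal X^n\to\{1,\dots,|\mathcal X|^n\}$. For a set $S$ of disks write $M_S=(M_i)_{i\in S}$. Below, $\mathcal B$ ranges over the subsets of $\{1,\dots,\delta\}$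 of size $\nu$, $\mathcal E$ ranges over those of size $\eta$, and $G_{\mathcal B}(\cdot|y,m_{\mathcal B})$, $G_{\mathcal E}(\cdot|y,m_{\mathcal E})$ are guessing functions for every value of the conditioning variables. Bob's ambiguity is, in the guessing version and in the list version respectively, $$\mathscr A_B^{(g)}=\min_{(G_{\mathcal B})}\mathbb E\Bigl[\max_{\mathcal B}G_{\mathcal B}(X^n|Y^n,M_{\mathcal B})^\rho\Bigr],\qquad \mathscr A_B^{(l)}=\mathbb E\Bigl[\max_{\mathcal B}\bigl|\mathcal L^{Y^n}_{M_{\mathcal B}}\bigr|^\rho\Bigr],$$ where $\mathcal L^{y}_{m_{\mathcal B}}$ is the set of all $x\in\mathcal X^n$ with $\Pr[X^n=x\mid Y^n=y,M_{\mathcal B}=m_{\mathcal B}]>0$. Eve's ambiguity, in both versions, is $$\mathscr A_E=\min_{(G_{\mathcal E})}\mathbb E\Bigl[\min_{\mathcal E}G_{\mathcal E}(X^n|Y^n,M_{\mathcal E})^\rho\Bigr].$$ For either version, the privacy-exponent $\overline{E_E}$ is the supremum of all real $E$ for which there is a sequence of encoders (one for each $n$) with $\lim_{n}\mathscr A_B=1$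 and $\liminf_{n}\frac1n\log\mathscr A_E\ge E$. For $E_B\ge 0$, the modest privacy-exponent $\overline{E_E^m(E_B)}$ is the supremum of all real $E$ for which there is a sequence of encoders with $\limsup_n\frac1n\log\mathscr A_B\le E_B$ and $\liminf_n\frac1n\log\mathscr A_E\ge E$. The supremum of the empty set is $-\infty$. Then, in both the guessing version and the list version, $$\overline{E_E}=\begin{cases}\rho\,\min\{R_s(\nu-\eta),\,H\} & \text{if }\nu R_s>H,\\ -\infty & \text{if }\nu R_s<H,\end{cases}$$ and, for every $E_B\ge 0$, $$\overline{E_E^m(E_B)}=\begin{cases}\min\{\rho R_s(\nu-\eta)+E_B,\ \rho H\} & \text{if }\nu R_s\ge H-\rho^{-1}E_B,\\ -\infty & \text{if }\nu R_s<H-\rho^{-1}E_B,\end{cases}$$ where, in the list version, the first case of the formula for $\overline{E_E^m(E_B)}$ is asserted only for $R_s>0$. -/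

import Mathlib

namespace DiskFailure

noncomputable section

/-- The conditional Rényi entropy of order `α` (Arimoto), in bits, of a joint mass function
`P x y`, for `α ∈ (0, 1) ∪ (1, ∞)`:
`α / (1 - α) * log₂ ∑ y, (∑ x, P x y ^ α) ^ (1 / α)`. -/
def condRenyiEntropy {A B : Type*} [Fintype A] [Fintype B] (α : ℝ) (P : A → B → ℝ) : ℝ :=
  α / (1 - α) * Real.logb 2 (∑ y, (∑ x, P x y ^ α) ^ (1 / α))

/-- The joint mass function of `(X^n, Y^n)`, where `X^n` and `Y^n` are the first `n` entries. -/
def blockPMF {Ω A B : Type*} [MeasurableSpace Ω] (μ : MeasureTheory.Measure Ω)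
    (X : ℕ → Ω → A) (Y : ℕ → Ω → B) (n : ℕ) (x : Fin n → A) (y : Fin n → B) : ℝ :=
  μ.real {ω | (∀ i : Fin n, X i ω = x i) ∧ (∀ i : Fin n, Y i ω = y i)}

/-- A hint of `s` bits: a set of `2 ^ s` elements (only its cardinality matters). -/
abbrev Hint (s : ℕ) : Type := Fin s → Bool

/-- A stochastic encoder: for every `(x, y)` a conditional distribution of the `δ` hints. -/
abbrev Encoder (A B : Type*) (δ s : ℕ) := A → B → PMF (Fin δ → Hint s)

/-- The sets of `k` disks. -/
abbrev Disks (δ k : ℕ) : Type := {S : Finset (Fin δ) // S.card = k}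

/-- A guessing function: `G x` is the position, counted from `0`, at which `x` is guessed. -/
abbrev GuessingFn (A : Type*) [Fintype A] := A ≃ Fin (Fintype.card A)

/-- The number of guesses that are made until `x` is guessed, an element of `{1, …, |A|}`. -/
def GuessingFn.numGuesses {A : Type*} [Fintype A] (G : GuessingFn A) (x : A) : ℕ := (G x : ℕ) + 1

/-- For every set `S` of `k` disks, a guessing function for `X` given `Y` and the hints in `S`. -/
abbrev GuessingStrategy (A B : Type*) [Fintype A] (δ s k : ℕ) :=
  (S : Disks δ k) → B → (S.1 → Hint s) → GuessingFn A

section OneShot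

variable {A B : Type*} [Fintype A] [Fintype B] {δ s : ℕ}

/-- The expectation of `f (X, Y, M)` for `(X, Y) ∼ P` and `M` drawn by the encoder. -/
def expect (P : A → B → ℝ) (W : Encoder A B δ s) (f : A → B → (Fin δ → Hint s) → ℝ) : ℝ :=
  ∑ x, ∑ y, ∑ m, P x y * (W x y m).toReal * f x y m

/-- The conditional probability that the hints in `S` equal `m`, given `(X, Y) = (x, y)`. -/
def hintProb (W : Encoder A B δ s) (S : Finset (Fin δ)) (m : S → Hint s) (x : A) (y : B) : ℝ :=
  ∑ m' : Fin δ → Hint s with S.restrict m' = m, (W x y m').toReal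

/-- The posterior probability of `X = x` given `Y = y` and that the hints in `S` equal `m`. -/
def posterior (P : A → B → ℝ) (W : Encoder A B δ s) (S : Finset (Fin δ)) (m : S → Hint s)
    (x : A) (y : B) : ℝ :=
  P x y * hintProb W S m x y / ∑ x', P x' y * hintProb W S m x' y

/-- The list of all realizations of `X` of positive posterior probability. -/
def decodingList (P : A → B → ℝ) (W : Encoder A B δ s) (S : Finset (Fin δ)) (y : B)
    (m : S → Hint s) : Finset A :=
  {x : A | 0 < posterior P W S m x y}

/-- Bob's ambiguity in the guessing version; he sees a worst-case set of `ν` hints. -/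
def bobGuessAmbiguity (ρ : ℝ) (ν : ℕ) (P : A → B → ℝ) (W : Encoder A B δ s) : ℝ :=
  ⨅ G : GuessingStrategy A B δ s ν, expect P W fun x y m =>
    ⨆ S : Disks δ ν, ((G S y (S.1.restrict m)).numGuesses x : ℝ) ^ ρ

/-- Bob's ambiguity in the list version; he sees a worst-case set of `ν` hints. -/
def bobListAmbiguity (ρ : ℝ) (ν : ℕ) (P : A → B → ℝ) (W : Encoder A B δ s) : ℝ :=
  expect P W fun _ y m =>
    ⨆ S : Disks δ ν, ((decodingList P W S.1 y (S.1.restrict m)).card : ℝ) ^ ρ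

/-- Eve's ambiguity; she sees a set of `η` hints that is the best one for her. -/
def eveAmbiguity (ρ : ℝ) (η : ℕ) (P : A → B → ℝ) (W : Encoder A B δ s) : ℝ :=
  ⨅ G : GuessingStrategy A B δ s η, expect P W fun x y m =>
    ⨅ S : Disks δ η, ((G S y (S.1.restrict m)).numGuesses x : ℝ) ^ ρ

end OneShot

/-- The two versions of the problem, which differ in the definition of Bob's ambiguity. -/
inductive Version
  | guessing
  | list

/-- Bob's ambiguity in either version of the problem. -/
def bobAmbiguity {A B : Type*} [Fintype A] [Fintype B] {δ s : ℕ} :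
    Version → ℝ → ℕ → (A → B → ℝ) → Encoder A B δ s → ℝ
  | .guessing => bobGuessAmbiguity
  | .list => bobListAmbiguity

section Asymptotic

variable {A B : Type*} [Fintype A] [Fintype B]

/-- The number of bits per hint, at blocklength `n` and per-hint storage rate `R`. -/
abbrev hintBits (R : ℝ) (n : ℕ) : ℕ := ⌊(n : ℝ) * R⌋₊

/-- A sequence of stochastic encoders, one for each blocklength. -/
abbrev EncoderSeq (A B : Type*) (δ : ℕ) (R : ℝ) :=
  (n : ℕ) → Encoder (Fin n → A) (Fin n → B) δ (hintBits R n)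

/-- `E` is an achievable ambiguity-exponent; `P n` is the mass function of `(X^n, Y^n)`. -/
def IsAchievable (v : Version) (ρ : ℝ) (δ ν η : ℕ) (R : ℝ)
    (P : (n : ℕ) → (Fin n → A) → (Fin n → B) → ℝ) (E : ℝ) : Prop :=
  ∃ W : EncoderSeq A B δ R,
    Filter.Tendsto (fun n => bobAmbiguity v ρ ν (P n) (W n)) Filter.atTop (nhds 1) ∧
    (E : EReal) ≤ Filter.liminf
      (fun n : ℕ => ((Real.logb 2 (eveAmbiguity ρ η (P n) (W n)) / n : ℝ) : EReal)) Filter.atTop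

/-- `E` is an achievable modest-ambiguity-exponent for the exponent `EB` granted to Bob. -/
def IsModestAchievable (v : Version) (ρ : ℝ) (δ ν η : ℕ) (R : ℝ)
    (P : (n : ℕ) → (Fin n → A) → (Fin n → B) → ℝ) (EB E : ℝ) : Prop :=
  ∃ W : EncoderSeq A B δ R,
    Filter.limsup (fun n : ℕ => ((Real.logb 2 (bobAmbiguity v ρ ν (P n) (W n)) / n : ℝ) : EReal))
      Filter.atTop ≤ (EB : EReal) ∧
    (E : EReal) ≤ Filter.liminf
      (fun n : ℕ => ((Real.logb 2 (eveAmbiguity ρ η (P n) (W n)) / n : ℝ) : EReal)) Filter.atTop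

/-- The privacy-exponent: the supremum of all achievable ambiguity-exponents, which is
`⊥ = -∞` if there are none. -/
def privacyExponent (v : Version) (ρ : ℝ) (δ ν η : ℕ) (R : ℝ)
    (P : (n : ℕ) → (Fin n → A) → (Fin n → B) → ℝ) : EReal :=
  ⨆ E : {E : ℝ // IsAchievable v ρ δ ν η R P E}, ((E : ℝ) : EReal)

/-- The modest privacy-exponent: the supremum of all achievable modest-ambiguity-exponents,
which is `⊥ = -∞` if there are none. -/
def modestPrivacyExponent (v : Version) (ρ : ℝ) (δ ν η : ℕ) (R : ℝ)
    (P : (n : ℕ) → (Fin n → A) → (Fin n → B) → ℝ) (EB : ℝ) : EReal :=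
  ⨆ E : {E : ℝ // IsModestAchievable v ρ δ ν η R P EB E}, ((E : ℝ) : EReal)

end Asymptotic

end

end DiskFailure

/-! Everything is reduced to one-shot inequalities for `renyiSum ρ P`, which equals `2 ^ (ρ *
H_ρ̃(X|Y))`; taking `logb 2`, dividing by `n` and passing to the limit then gives the exponents.

Converse. Eve can ignore the hints and guess in decreasing order of probability, so her ambiguity is
at most `renyiSum`. She can also run Bob's strategy while trying all values of the `ν - η` hints she
lacks, so her ambiguity is at most `2 ^ (ρ * s * (ν - η))` times Bob's. The same argument with `η =
0`, together with Arikan's lower bound for guessing without hints, shows that Bob's ambiguity is at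
least about `2 ^ (-ρ * ν * s)` times `renyiSum`. The last bound is the source of the value `-∞`. It
suffices to argue for Bob's guessing ambiguity, which never exceeds his list ambiguity.

Direct part. The source symbol is compressed to a label of `ν * s - a` bits, and label and `a ≤ η *
s` random bits are stored by a Reed–Solomon code. Any `ν` hints reveal the label, so Bob's list is a
label class (`GuessingFn.exists_label_rpow_le`). For a fixed label, any `η` hints determine the
random bits, so for Eve the randomness adds `a` bits to the source entropy, against `η * s` bits of
observation (`renyiSum_le_mul_eveAmbiguity`). With `α = lim a / n` the exponents are `max 0 (ρ * (H
- (ν * Rs - α)))` for Bob and at least `ρ * (α + H - η * Rs)` for Eve; the largest `α` that Bob's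
constraint permits matches the converse. -/

namespace DiskFailure

open Finset

/-! ### Guessing functions and the inequality behind Arikan's bound -/

section Guessing

variable {A : Type*} [Fintype A]

theorem GuessingFn.one_le_numGuesses (G : GuessingFn A) (x : A) : (1 : ℝ) ≤ G.numGuesses x := by
  simp [GuessingFn.numGuesses]

theorem GuessingFn.numGuesses_pos (G : GuessingFn A) (x : A) : (0 : ℝ) < G.numGuesses x :=
  zero_lt_one.trans_le (G.one_le_numGuesses x)

theorem GuessingFn.numGuesses_injective (G : GuessingFn A) : Function.Injective G.numGuesses := by
  intro x y h
  apply G.injective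
  apply Fin.ext
  simpa [GuessingFn.numGuesses] using h

theorem GuessingFn.numGuesses_le (G : GuessingFn A) (x : A) : G.numGuesses x ≤ Fintype.card A :=
  (G x).2

theorem GuessingFn.card_le (G : GuessingFn A) (t : ℝ) (ht : 0 ≤ t) :
    (#{x | (G.numGuesses x : ℝ) ≤ t} : ℝ) ≤ t := by
  have h : #{x | (G.numGuesses x : ℝ) ≤ t} ≤ #(Icc 1 ⌊t⌋₊) := by
    apply card_le_card_of_injOn G.numGuesses
    · intro x hx
      simp only [coe_filter, mem_univ, true_and, Set.mem_ofPred_eq] at hx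
      simp only [coe_Icc, Set.mem_Icc]
      exact ⟨Nat.succ_le_succ (Nat.zero_le _), Nat.le_floor hx⟩
    · exact G.numGuesses_injective.injOn
  rw [Nat.card_Icc, Nat.add_sub_cancel] at h
  exact (Nat.cast_le.mpr h).trans (Nat.floor_le ht)

/-- A guessing function that guesses in the order of increasing cost. -/
theorem exists_guessingFn_le (c : A → ℝ) :
    ∃ G : GuessingFn A, ∀ x, G.numGuesses x ≤ #{x' | c x' ≤ c x} := by
  classical
  let e := Fintype.equivFin A
  let f : Fin (Fintype.card A) → ℝ := c ∘ e.symm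
  let σ := Tuple.sort f
  have hmono : Monotone (f ∘ σ) := Tuple.monotone_sort f
  refine ⟨e.trans σ.symm, fun x => ?_⟩
  set i := σ.symm (e x) with hi
  have hcard : #((Iic i).image (e.symm ∘ σ)) = (i : ℕ) + 1 := by
    rw [card_image_of_injective _ (e.symm.injective.comp σ.injective), Fin.card_Iic]
  have : GuessingFn.numGuesses (e.trans σ.symm) x = (i : ℕ) + 1 := rfl
  rw [this, ← hcard]
  apply card_le_card
  intro x' hx'
  obtain ⟨j, hj, rfl⟩ := mem_image.mp hx'
  have h := hmono (mem_Iic.mp hj)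
  simp only [mem_filter, mem_univ, true_and]
  simpa [f, hi] using h

/-- The numbers of guesses are exactly `1, …, |A|`, so this is a harmonic sum. It supplies the
constant `C` of `sum_rpow_le_mul_sum_mul_rpow`; being only linear in `n` on `A ^ n`, it does not
affect exponents. -/
theorem GuessingFn.sum_inv_numGuesses_le (G : GuessingFn A) :
    ∑ x, (G.numGuesses x : ℝ)⁻¹ ≤ 1 + Real.log (Fintype.card A) := by
  have h : ∑ x, (G.numGuesses x : ℝ)⁻¹ = (harmonic (Fintype.card A) : ℝ) := by
    rw [harmonic, Rat.cast_sum, ← Fin.sum_univ_eq_sum_range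
      (fun i => (((↑(i + 1) : ℚ)⁻¹ : ℚ) : ℝ)), ← Equiv.sum_comp G]
    simp [GuessingFn.numGuesses]
  rw [h]
  exact harmonic_le_one_add_log _

theorem one_add_log_card_pos (A : Type*) [Fintype A] : 0 < 1 + Real.log (Fintype.card A) := by
  have := Real.log_natCast_nonneg (Fintype.card A)
  positivity

end Guessing

/-- A reverse form of Hölder's inequality. -/
theorem sum_rpow_le_mul_sum_mul_rpow {ι : Type*} [Fintype ι] {ρ : ℝ} (hρ : 0 < ρ) (p g : ι → ℝ)
    (hp : ∀ i, 0 ≤ p i) (hg : ∀ i, 0 < g i) {C : ℝ} (hC : ∑ i, (g i)⁻¹ ≤ C) :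
    (∑ i, p i ^ (1 / (1 + ρ))) ^ (1 + ρ) ≤ C ^ ρ * ∑ i, p i * g i ^ ρ := by
  have h1 : 0 < 1 + ρ := by positivity
  have hpq : (1 + ρ).HolderConjugate ((1 + ρ) / ρ) := by
    rw [Real.holderConjugate_iff]
    constructor
    · linarith
    · field_simp
  -- Hölder with exponents `1 + ρ` and `(1 + ρ) / ρ`, applied to `p = (p * g ^ ρ) * g⁻¹ ^ ρ` raised
  -- to the power `1 / (1 + ρ)`.
  have key := Real.inner_le_Lp_mul_Lq_of_nonneg univ hpq
    (f := fun i => (p i * g i ^ ρ) ^ (1 / (1 + ρ))) (g := fun i => ((g i)⁻¹ ^ ρ) ^ (1 / (1 + ρ)))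
    (fun i _ => by have := hp i; have := hg i; positivity)
    (fun i _ => by have := hg i; positivity)
  have e1 : ∀ i, (p i * g i ^ ρ) ^ (1 / (1 + ρ)) * ((g i)⁻¹ ^ ρ) ^ (1 / (1 + ρ))
      = p i ^ (1 / (1 + ρ)) := fun i => by
    have hgi := hg i
    have hpi := hp i
    rw [← Real.mul_rpow (by positivity) (by positivity), mul_assoc,
      ← Real.mul_rpow hgi.le (by positivity), mul_inv_cancel₀ hgi.ne', Real.one_rpow, mul_one]
  have e2 : ∀ i, ((p i * g i ^ ρ) ^ (1 / (1 + ρ))) ^ (1 + ρ) = p i * g i ^ ρ := fun i => by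
    have hgi := hg i
    have hpi := hp i
    rw [← Real.rpow_mul (by positivity), one_div, inv_mul_cancel₀ h1.ne', Real.rpow_one]
  have e3 : ∀ i, (((g i)⁻¹ ^ ρ) ^ (1 / (1 + ρ))) ^ ((1 + ρ) / ρ) = (g i)⁻¹ := fun i => by
    have hgi := hg i
    rw [← Real.rpow_mul (by positivity), ← Real.rpow_mul (by positivity)]
    have : ρ * (1 / (1 + ρ) * ((1 + ρ) / ρ)) = 1 := by field_simp
    rw [this, Real.rpow_one]
  simp only [e1, e2, e3] at key
  have hS : 0 ≤ ∑ i, p i * g i ^ ρ :=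
    sum_nonneg fun i _ => mul_nonneg (hp i) (Real.rpow_nonneg (hg i).le _)
  have hI : 0 ≤ ∑ i, (g i)⁻¹ := sum_nonneg fun i _ => (inv_pos.mpr (hg i)).le
  calc (∑ i, p i ^ (1 / (1 + ρ))) ^ (1 + ρ)
      ≤ ((∑ i, p i * g i ^ ρ) ^ (1 / (1 + ρ)) * (∑ i, (g i)⁻¹) ^ (1 / ((1 + ρ) / ρ))) ^ (1 + ρ) :=
        Real.rpow_le_rpow (sum_nonneg fun i _ => Real.rpow_nonneg (hp i) _) key h1.le
    _ = (∑ i, (g i)⁻¹) ^ ρ * ∑ i, p i * g i ^ ρ := by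
        rw [Real.mul_rpow (by positivity) (by positivity), ← Real.rpow_mul hS,
          ← Real.rpow_mul hI, one_div, inv_mul_cancel₀ h1.ne', Real.rpow_one, mul_comm]
        congr 2
        field_simp
    _ ≤ C ^ ρ * ∑ i, p i * g i ^ ρ := by gcongr

/-! ### One-shot bounds on the ambiguities of Bob and Eve -/

section OneShot

set_option linter.unusedSectionVars false

variable {A B : Type*} [Fintype A] [Fintype B] {δ s : ℕ}

/-- The quantity `2 ^ (ρ * H)`, where `H` is the conditional Rényi entropy of order
`1 / (1 + ρ)`. -/
noncomputable def renyiSum (ρ : ℝ) (P : A → B → ℝ) : ℝ :=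
  ∑ y, (∑ x, P x y ^ (1 / (1 + ρ))) ^ (1 + ρ)

theorem sum_toReal_eq_one {α : Type*} [Fintype α] (p : PMF α) : ∑ a, (p a).toReal = 1 := by
  rw [← ENNReal.toReal_sum fun a _ => p.apply_ne_top a, ← tsum_fintype (L := .unconditional _),
    p.tsum_coe, ENNReal.toReal_one]

theorem expect_mono {P : A → B → ℝ} (hP : ∀ x y, 0 ≤ P x y) (W : Encoder A B δ s)
    {f g : A → B → (Fin δ → Hint s) → ℝ}
    (h : ∀ x y m, 0 < P x y → 0 < (W x y m).toReal → f x y m ≤ g x y m) :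
    expect P W f ≤ expect P W g := by
  refine sum_le_sum fun x _ => sum_le_sum fun y _ => sum_le_sum fun m _ => ?_
  rcases (hP x y).eq_or_lt' with h0 | h0
  · simp [h0]
  rcases (ENNReal.toReal_nonneg (a := W x y m)).eq_or_lt' with h1 | h1
  · simp [h1]
  exact mul_le_mul_of_nonneg_left (h x y m h0 h1) (by positivity)

theorem expect_const_mul (P : A → B → ℝ) (W : Encoder A B δ s)
    (f : A → B → (Fin δ → Hint s) → ℝ) (c : ℝ) :
    expect P W (fun x y m => c * f x y m) = c * expect P W f := by
  simp only [expect, mul_sum]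
  refine sum_congr rfl fun x _ => sum_congr rfl fun y _ => sum_congr rfl fun m _ => ?_
  ring

theorem expect_of_forall_eq (P : A → B → ℝ) (W : Encoder A B δ s) (f : A → B → ℝ) :
    expect P W (fun x y _ => f x y) = ∑ x, ∑ y, P x y * f x y := by
  simp only [expect]
  refine sum_congr rfl fun x _ => sum_congr rfl fun y _ => ?_
  rw [← sum_mul, ← mul_sum, sum_toReal_eq_one, mul_one]

instance instNonemptyGuessingFn : Nonempty (GuessingFn A) := ⟨Fintype.equivFin A⟩

instance instFiniteGuessingFn : Finite (GuessingFn A) :=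
  inferInstanceAs (Finite (A ≃ Fin (Fintype.card A)))

theorem nonempty_disks {k : ℕ} (h : k ≤ δ) : Nonempty (Disks δ k) := by
  obtain ⟨S, -, hS⟩ := exists_subset_card_eq (s := (univ : Finset (Fin δ))) (n := k) (by simpa)
  exact ⟨⟨S, hS⟩⟩

theorem le_ciSup_of_finite {ι : Type*} [Finite ι] (f : ι → ℝ) (i : ι) : f i ≤ ⨆ j, f j :=
  le_ciSup (Set.finite_range f).bddAbove i

theorem ciInf_le_of_finite {ι : Type*} [Finite ι] (f : ι → ℝ) (i : ι) : ⨅ j, f j ≤ f i :=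
  ciInf_le (Set.finite_range f).bddBelow i

theorem one_le_expect {P : A → B → ℝ} (hP : ∀ x y, 0 ≤ P x y) (hP1 : ∑ x, ∑ y, P x y = 1)
    (W : Encoder A B δ s) {f : A → B → (Fin δ → Hint s) → ℝ} (h : ∀ x y m, 1 ≤ f x y m) :
    1 ≤ expect P W f := by
  refine le_trans ?_ (expect_mono hP W (f := fun _ _ _ => 1) fun x y m _ _ => h x y m)
  simp [expect_of_forall_eq, hP1]

theorem one_le_eveAmbiguity {ρ : ℝ} (hρ : 0 < ρ) {η : ℕ} (hη : η ≤ δ)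
    {P : A → B → ℝ} (hP : ∀ x y, 0 ≤ P x y) (hP1 : ∑ x, ∑ y, P x y = 1)
    (W : Encoder A B δ s) : 1 ≤ eveAmbiguity ρ η P W := by
  have := nonempty_disks hη
  exact le_ciInf fun G => one_le_expect hP hP1 W fun x y m =>
    le_ciInf fun S => Real.one_le_rpow (GuessingFn.one_le_numGuesses _ _) hρ.le

theorem one_le_bobGuessAmbiguity {ρ : ℝ} (hρ : 0 < ρ) {ν : ℕ} (hν : ν ≤ δ)
    {P : A → B → ℝ} (hP : ∀ x y, 0 ≤ P x y) (hP1 : ∑ x, ∑ y, P x y = 1)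
    (W : Encoder A B δ s) : 1 ≤ bobGuessAmbiguity ρ ν P W := by
  obtain ⟨S⟩ := nonempty_disks hν
  refine le_ciInf fun G => one_le_expect hP hP1 W fun x y m => ?_
  refine le_trans ?_ (le_ciSup_of_finite _ S)
  exact Real.one_le_rpow (GuessingFn.one_le_numGuesses _ _) hρ.le

/-- Guessing in decreasing order of probability. -/
theorem exists_guessingFn_sum_le_renyiSum {ρ : ℝ} (hρ : 0 < ρ)
    {P : A → B → ℝ} (hP : ∀ x y, 0 ≤ P x y) :
    ∃ G : B → GuessingFn A,
      ∑ x, ∑ y, P x y * ((G y).numGuesses x : ℝ) ^ ρ ≤ renyiSum ρ P := by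
  choose G hG using fun y => exists_guessingFn_le (fun x => -P x y)
  refine ⟨G, ?_⟩
  rw [sum_comm, renyiSum]
  refine sum_le_sum fun y _ => ?_
  set T := ∑ x, P x y ^ (1 / (1 + ρ)) with hT
  have hT0 : 0 ≤ T := sum_nonneg fun x _ => Real.rpow_nonneg (hP x y) _
  have h1 : 0 < 1 + ρ := by positivity
  have hx : ∀ x, P x y * ((G y).numGuesses x : ℝ) ^ ρ ≤ P x y ^ (1 / (1 + ρ)) * T ^ ρ := by
    intro x
    rcases (hP x y).eq_or_lt' with h0 | h0
    · rw [h0, zero_mul]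
      positivity
    have hq : 0 < P x y ^ (1 / (1 + ρ)) := by positivity
    -- The number of guesses is at most the number of symbols at least as likely as `x`, and each of
    -- these contributes at least `P x y ^ (1 / (1 + ρ))` to `T`.
    have hle : ((G y).numGuesses x : ℝ) * P x y ^ (1 / (1 + ρ)) ≤ T := by
      calc ((G y).numGuesses x : ℝ) * P x y ^ (1 / (1 + ρ))
          ≤ (#{x' | -P x' y ≤ -P x y} : ℝ) * P x y ^ (1 / (1 + ρ)) := by
            gcongr
            exact hG y x
        _ = ∑ x' with -P x' y ≤ -P x y, P x y ^ (1 / (1 + ρ)) := by simp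
        _ ≤ ∑ x' with -P x' y ≤ -P x y, P x' y ^ (1 / (1 + ρ)) := by
            refine sum_le_sum fun x' hx' => ?_
            have := (mem_filter.mp hx').2
            exact Real.rpow_le_rpow h0.le (by linarith) (by positivity)
        _ ≤ T := sum_le_sum_of_subset_of_nonneg (filter_subset _ _)
            fun x' _ _ => Real.rpow_nonneg (hP x' y) _
    have hP' : P x y = P x y ^ (1 / (1 + ρ)) * (P x y ^ (1 / (1 + ρ))) ^ ρ := by
      rw [← Real.rpow_mul h0.le, ← Real.rpow_add h0]
      have : 1 / (1 + ρ) + 1 / (1 + ρ) * ρ = 1 := by field_simp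
      rw [this, Real.rpow_one]
    calc P x y * ((G y).numGuesses x : ℝ) ^ ρ
        = P x y ^ (1 / (1 + ρ)) * (((G y).numGuesses x : ℝ) * P x y ^ (1 / (1 + ρ))) ^ ρ := by
          rw [Real.mul_rpow (by positivity) hq.le]
          nth_rewrite 1 [hP']
          ring
      _ ≤ _ := by gcongr
  refine (sum_le_sum fun x _ => hx x).trans ?_
  rw [← sum_mul, ← hT, Real.rpow_add' hT0 h1.ne', Real.rpow_one]

theorem eveAmbiguity_le_renyiSum {ρ : ℝ} (hρ : 0 < ρ) {η : ℕ} (hη : η ≤ δ)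
    {P : A → B → ℝ} (hP : ∀ x y, 0 ≤ P x y) (W : Encoder A B δ s) :
    eveAmbiguity ρ η P W ≤ renyiSum ρ P := by
  obtain ⟨G, hG⟩ := exists_guessingFn_sum_le_renyiSum hρ hP
  have := nonempty_disks hη
  refine (ciInf_le_of_finite _ fun _ y _ => G y).trans (le_trans (le_of_eq ?_) hG)
  simp only [ciInf_const]
  exact expect_of_forall_eq P W _

theorem bobGuessAmbiguity_le_renyiSum {ρ : ℝ} (hρ : 0 < ρ) {ν : ℕ} (hν : ν ≤ δ)
    {P : A → B → ℝ} (hP : ∀ x y, 0 ≤ P x y) (W : Encoder A B δ s) :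
    bobGuessAmbiguity ρ ν P W ≤ renyiSum ρ P := by
  obtain ⟨G, hG⟩ := exists_guessingFn_sum_le_renyiSum hρ hP
  have := nonempty_disks hν
  refine (ciInf_le_of_finite _ fun _ y _ => G y).trans (le_trans (le_of_eq ?_) hG)
  simp only [ciSup_const]
  exact expect_of_forall_eq P W _

theorem hintProb_nonneg (W : Encoder A B δ s) (S : Finset (Fin δ)) (m : S → Hint s)
    (x : A) (y : B) : 0 ≤ hintProb W S m x y :=
  sum_nonneg fun _ _ => ENNReal.toReal_nonneg

theorem mem_decodingList {P : A → B → ℝ} (hP : ∀ x y, 0 ≤ P x y) (W : Encoder A B δ s)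
    (S : Finset (Fin δ)) {m : Fin δ → Hint s} {x : A} {y : B} (hx : 0 < P x y)
    (hW : 0 < (W x y m).toReal) : x ∈ decodingList P W S y (S.restrict m) := by
  have h1 : 0 < hintProb W S (S.restrict m) x y :=
    hW.trans_le (single_le_sum (f := fun m' => (W x y m').toReal)
      (fun _ _ => ENNReal.toReal_nonneg) (mem_filter.mpr ⟨mem_univ m, rfl⟩))
  have h2 : 0 < P x y * hintProb W S (S.restrict m) x y := mul_pos hx h1
  have h3 : 0 < ∑ x', P x' y * hintProb W S (S.restrict m) x' y :=
    h2.trans_le (single_le_sum (f := fun x' => P x' y * hintProb W S (S.restrict m) x' y)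
      (fun x' _ => mul_nonneg (hP x' y) (hintProb_nonneg _ _ _ _ _)) (mem_univ x))
  exact mem_filter.mpr ⟨mem_univ x, div_pos h2 h3⟩

theorem exists_of_mem_decodingList {P : A → B → ℝ} {W : Encoder A B δ s}
    {S : Finset (Fin δ)} {m : S → Hint s} {x : A} {y : B} (hx : x ∈ decodingList P W S y m) :
    ∃ m', S.restrict m' = m ∧ W x y m' ≠ 0 := by
  by_contra! h
  have h0 : hintProb W S m x y = 0 :=
    sum_eq_zero fun m' hm' => by rw [h m' (mem_filter.mp hm').2, ENNReal.toReal_zero]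
  have h1 : 0 < posterior P W S m x y := (mem_filter.mp hx).2
  rw [posterior, h0, mul_zero, zero_div] at h1
  exact h1.false

/-- Guess the elements of the list before all others: the true symbol lies in the list whenever the
outcome has positive probability, so its position is at most the size of the list. -/
theorem bobGuessAmbiguity_le_bobListAmbiguity {ρ : ℝ} (hρ : 0 < ρ) {ν : ℕ} (hν : ν ≤ δ)
    {P : A → B → ℝ} (hP : ∀ x y, 0 ≤ P x y) (W : Encoder A B δ s) :
    bobGuessAmbiguity ρ ν P W ≤ bobListAmbiguity ρ ν P W := by
  classical
  have := nonempty_disks hν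
  choose G hG using fun (S : Disks δ ν) (y : B) (m : S.1 → Hint s) =>
    exists_guessingFn_le (fun x => if x ∈ decodingList P W S.1 y m then (0 : ℝ) else 1)
  refine (ciInf_le_of_finite _ G).trans (expect_mono hP W fun x y m hx hW => ?_)
  refine ciSup_mono (Set.finite_range _).bddAbove fun S => ?_
  refine Real.rpow_le_rpow (by positivity) ?_ hρ.le
  rw [Nat.cast_le]
  refine (hG S y _ x).trans (card_le_card fun x' hx' => ?_)
  have hmem := mem_decodingList hP W S.1 hx hW
  have h := (mem_filter.mp hx').2
  by_contra hcon
  rw [if_pos hmem, if_neg hcon] at h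
  linarith

/-- Arikan's lower bound. With no hints there is a single disk set and a single hint vector, so the
infimum over disk sets disappears and the reverse Hölder inequality applies for each `y`. -/
theorem renyiSum_le_mul_eveAmbiguity_zero {ρ : ℝ} (hρ : 0 < ρ)
    {P : A → B → ℝ} (hP : ∀ x y, 0 ≤ P x y) (W : Encoder A B δ s) :
    renyiSum ρ P ≤ (1 + Real.log (Fintype.card A)) ^ ρ * eveAmbiguity ρ 0 P W := by
  have hne := nonempty_disks (Nat.zero_le δ)
  obtain ⟨G, hG⟩ := exists_eq_ciInf_of_finite (f := fun G : GuessingStrategy A B δ s 0 =>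
    expect P W fun x y m => ⨅ S : Disks δ 0, ((G S y (S.1.restrict m)).numGuesses x : ℝ) ^ ρ)
  rw [eveAmbiguity, ← hG]
  let S₀ : Disks δ 0 := ⟨∅, rfl⟩
  let m₀ : (∅ : Finset (Fin δ)) → Hint s := fun i => absurd i.2 (notMem_empty _)
  have hinf : ∀ x y (m : Fin δ → Hint s), (⨅ S : Disks δ 0, ((G S y (S.1.restrict m)).numGuesses x : ℝ) ^ ρ)
      = ((G S₀ y m₀).numGuesses x : ℝ) ^ ρ := by
    intro x y m
    have : Unique (Disks δ 0) := ⟨⟨S₀⟩, fun S => Subtype.ext (card_eq_zero.mp S.2)⟩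
    rw [ciInf_unique]
    have hd : (default : Disks δ 0) = S₀ := Subsingleton.elim _ _
    rw [hd]
    congr 4
    exact Subsingleton.elim (α := (∅ : Finset (Fin δ)) → Hint s) _ _
  simp only [hinf]
  rw [expect_of_forall_eq P W (fun x y => ((G S₀ y m₀).numGuesses x : ℝ) ^ ρ), sum_comm, mul_sum,
    renyiSum]
  exact sum_le_sum fun y _ => sum_rpow_le_mul_sum_mul_rpow hρ _ _ (fun x => hP x y)
    (fun x => GuessingFn.numGuesses_pos _ x) (GuessingFn.sum_inv_numGuesses_le _)

/-- Eve can guess the hints that Bob sees and she does not. -/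
theorem eveAmbiguity_le_mul_bobGuessAmbiguity {ρ : ℝ} (hρ : 0 < ρ) {η ν : ℕ} (hην : η ≤ ν)
    (hν : ν ≤ δ) {P : A → B → ℝ} (hP : ∀ x y, 0 ≤ P x y) (W : Encoder A B δ s) :
    eveAmbiguity ρ η P W ≤ (((2 : ℝ) ^ s) ^ (ν - η)) ^ ρ * bobGuessAmbiguity ρ ν P W := by
  classical
  obtain ⟨⟨T, hT⟩⟩ := nonempty_disks hν
  obtain ⟨S, hST, hS⟩ := exists_subset_card_eq (s := T) (n := η) (by omega)
  obtain ⟨G, hG⟩ := exists_eq_ciInf_of_finite (f := fun G : GuessingStrategy A B δ s ν =>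
    expect P W fun x y m => ⨆ S : Disks δ ν, ((G S y (S.1.restrict m)).numGuesses x : ℝ) ^ ρ)
  rw [bobGuessAmbiguity, ← hG, ← expect_const_mul]
  -- the vectors of hints for `T` that agree with given hints, up to those in `T \ S`
  let ext (S' : Finset (Fin δ)) (m : S' → Hint s) (h : (T \ S : Finset (Fin δ)) → Hint s) :
      T → Hint s := fun i => if hi : (i : Fin δ) ∈ (T \ S : Finset (Fin δ)) then h ⟨i, hi⟩
        else if hi' : (i : Fin δ) ∈ S' then m ⟨i, hi'⟩ else fun _ => false
  have hne : Nonempty ((T \ S : Finset (Fin δ)) → Hint s) := ⟨fun _ _ => false⟩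
  -- The earliest position of `x` in Bob's guessing orders, over all values of the missing hints.
  -- For `S' = S` the default `false` in `ext` is never reached; Eve's strategies for other disk
  -- sets do not matter, since her infimum is bounded by the term of `S`.
  let c (S' : Finset (Fin δ)) (y : B) (m : S' → Hint s) (x : A) : ℝ :=
    ⨅ h, ((G ⟨T, hT⟩ y (ext S' m h)).numGuesses x : ℝ)
  choose F hF using fun (S' : Disks δ η) (y : B) (m : S'.1 → Hint s) =>
    exists_guessingFn_le (c S'.1 y m)
  refine (ciInf_le_of_finite _ F).trans (expect_mono hP W fun x y m _ _ => ?_)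
  refine (ciInf_le_of_finite _ (⟨S, hS⟩ : Disks δ η)).trans ?_
  refine le_trans ?_ (mul_le_mul_of_nonneg_left (le_ciSup_of_finite _ (⟨T, hT⟩ : Disks δ ν))
    (by positivity))
  rw [← Real.mul_rpow (by positivity) (by positivity)]
  refine Real.rpow_le_rpow (by positivity) ?_ hρ.le
  have hext : ext S (S.restrict m) ((T \ S).restrict m) = T.restrict m := by
    funext i
    have hiT := i.2
    by_cases hi : (i : Fin δ) ∈ S <;> simp [ext, hi]
  have hc : c S y (S.restrict m) x ≤ (G ⟨T, hT⟩ y (T.restrict m)).numGuesses x := by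
    refine (ciInf_le_of_finite _ ((T \ S).restrict m)).trans_eq ?_
    simp only [hext]
  have hcard : Fintype.card ((T \ S : Finset (Fin δ)) → Hint s) = (2 ^ s) ^ (ν - η) := by
    rw [Fintype.card_fun, Fintype.card_fun, Fintype.card_coe, card_sdiff_of_subset hST, hT, hS]
    simp
  set t := c S y (S.restrict m) x with ht
  have ht0 : 0 ≤ t := Real.iInf_nonneg fun h => by positivity
  calc ((F ⟨S, hS⟩ y (S.restrict m)).numGuesses x : ℝ)
      ≤ #{x' | c S y (S.restrict m) x' ≤ t} := Nat.cast_le.mpr (hF ⟨S, hS⟩ y _ x)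
    _ ≤ #(univ.biUnion fun h => ({x' | ((G ⟨T, hT⟩ y
          (ext S (S.restrict m) h)).numGuesses x' : ℝ) ≤ t} : Finset A)) := by
        refine Nat.cast_le.mpr (card_le_card fun x' hx' => ?_)
        obtain ⟨h, hh⟩ := exists_eq_ciInf_of_finite (f := fun h => ((G ⟨T, hT⟩ y
          (ext S (S.restrict m) h)).numGuesses x' : ℝ))
        refine mem_biUnion.mpr ⟨h, mem_univ h, mem_filter.mpr ⟨mem_univ _, ?_⟩⟩
        rw [hh]
        exact (mem_filter.mp hx').2
    _ ≤ ∑ h, (#{x' | ((G ⟨T, hT⟩ y (ext S (S.restrict m) h)).numGuesses x' : ℝ) ≤ t} : ℝ) := by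
        exact_mod_cast card_biUnion_le
    _ ≤ ∑ h : (T \ S : Finset (Fin δ)) → Hint s, t :=
        sum_le_sum fun h _ => GuessingFn.card_le _ t ht0
    _ = (((2 : ℝ) ^ s) ^ (ν - η)) * t := by
        rw [sum_const, card_univ, hcard, nsmul_eq_mul]
        push_cast
        rfl
    _ ≤ _ := by gcongr

/-- An Eve without hints who guesses all `ν` of Bob's hints is still subject to Arikan's bound. -/
theorem renyiSum_le_mul_bobGuessAmbiguity {ρ : ℝ} (hρ : 0 < ρ) {ν : ℕ}
    (hν : ν ≤ δ) {P : A → B → ℝ} (hP : ∀ x y, 0 ≤ P x y) (W : Encoder A B δ s) :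
    renyiSum ρ P ≤ (1 + Real.log (Fintype.card A)) ^ ρ *
      ((((2 : ℝ) ^ s) ^ ν) ^ ρ * bobGuessAmbiguity ρ ν P W) := by
  have h0 := (one_add_log_card_pos A).le
  refine (renyiSum_le_mul_eveAmbiguity_zero hρ hP W).trans ?_
  gcongr
  exact eveAmbiguity_le_mul_bobGuessAmbiguity hρ (Nat.zero_le ν) hν hP W

/-- The encoder that draws `r` uniformly at random and stores `c x y r`. -/
noncomputable def uniformEncoder {R : Type*} [Fintype R] [Nonempty R]
    (c : A → B → R → Fin δ → Hint s) : Encoder A B δ s :=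
  fun x y => (PMF.uniformOfFintype R).map (c x y)

theorem sum_uniformEncoder {R : Type*} [Fintype R] [Nonempty R]
    (c : A → B → R → Fin δ → Hint s) (x : A) (y : B) (f : (Fin δ → Hint s) → ℝ) :
    ∑ m, (uniformEncoder c x y m).toReal * f m
      = ∑ r, (Fintype.card R : ℝ)⁻¹ * f (c x y r) := by
  classical
  have h : ∀ m, (uniformEncoder c x y m).toReal
      = ∑ r, if m = c x y r then (Fintype.card R : ℝ)⁻¹ else 0 := by
    intro m
    rw [uniformEncoder, PMF.map_apply, tsum_fintype, ENNReal.toReal_sum]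
    · refine sum_congr rfl fun r _ => ?_
      split_ifs <;> simp
    · intro r _
      split_ifs <;> simp
  simp only [h, sum_mul]
  rw [sum_comm]
  refine sum_congr rfl fun r _ => ?_
  simp

theorem exists_of_uniformEncoder_ne_zero {R : Type*} [Fintype R] [Nonempty R]
    {c : A → B → R → Fin δ → Hint s} {x : A} {y : B} {m : Fin δ → Hint s}
    (h : uniformEncoder c x y m ≠ 0) : ∃ r, c x y r = m := by
  have := (PMF.mem_support_iff _ _).mpr h
  rw [uniformEncoder, PMF.support_map] at this
  obtain ⟨r, -, hr⟩ := this
  exact ⟨r, hr⟩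

/-- If any `η` hints reveal no more than `η * s` bits about the pair of the source and the local
randomness of the encoder, then Eve's ambiguity is large. -/
theorem renyiSum_le_mul_eveAmbiguity {ρ : ℝ} (hρ : 0 < ρ) {η : ℕ} (hη : η ≤ δ)
    {P : A → B → ℝ} (hP : ∀ x y, 0 ≤ P x y)
    {R : Type*} [Fintype R] [Nonempty R] (c : A → B → R → Fin δ → Hint s)
    (hc : ∀ x y, ∀ S : Disks δ η, Function.Injective fun r => S.1.restrict (c x y r)) :
    (Fintype.card R : ℝ) ^ ρ * renyiSum ρ P ≤
      (δ.choose η * (((2 : ℝ) ^ s) ^ η * (1 + Real.log (Fintype.card A)))) ^ ρ *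
        eveAmbiguity ρ η P (uniformEncoder c) := by
  have hne := nonempty_disks hη
  obtain ⟨G, hG⟩ := exists_eq_ciInf_of_finite (f := fun G : GuessingStrategy A B δ s η =>
    expect P (uniformEncoder c) fun x y m =>
      ⨅ S : Disks δ η, ((G S y (S.1.restrict m)).numGuesses x : ℝ) ^ ρ)
  rw [eveAmbiguity, ← hG]
  have h1 : 0 < 1 + ρ := by positivity
  have hR : (0 : ℝ) < Fintype.card R := by exact_mod_cast Fintype.card_pos
  -- the best disk set for Eve
  choose D hD using fun (y : B) (x : A) (r : R) => exists_eq_ciInf_of_finite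
    (f := fun S : Disks δ η => ((G S y (S.1.restrict (c x y r))).numGuesses x : ℝ) ^ ρ)
  -- The pair of source symbol and local randomness is treated as the source, with `g` the number of
  -- guesses for Eve's best disk set. It need not be injective in the pair: only the sum of its
  -- inverses is needed.
  let g (y : B) (i : A × R) : ℝ :=
    (G (D y i.1 i.2) y ((D y i.1 i.2).1.restrict (c i.1 y i.2))).numGuesses i.1
  have hexp : (expect P (uniformEncoder c) fun x y m =>
      ⨅ S : Disks δ η, ((G S y (S.1.restrict m)).numGuesses x : ℝ) ^ ρ)
      = ∑ y, ∑ i : A × R, (P i.1 y * (Fintype.card R : ℝ)⁻¹) * g y i ^ ρ := by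
    rw [expect, sum_comm]
    refine sum_congr rfl fun y _ => ?_
    rw [Fintype.sum_prod_type]
    refine sum_congr rfl fun x _ => ?_
    simp only [mul_assoc]
    rw [← mul_sum, sum_uniformEncoder c x y
      (fun m => ⨅ S : Disks δ η, ((G S y (S.1.restrict m)).numGuesses x : ℝ) ^ ρ), mul_sum]
    refine sum_congr rfl fun r _ => ?_
    rw [← hD y x r]
  rw [hexp, renyiSum, mul_sum, mul_sum]
  refine sum_le_sum fun y _ => ?_
  have hsum : ∑ i, (g y i)⁻¹ ≤
      δ.choose η * (((2 : ℝ) ^ s) ^ η * (1 + Real.log (Fintype.card A))) := by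
    calc ∑ i, (g y i)⁻¹
        ≤ ∑ i : A × R, ∑ S : Disks δ η,
            ((G S y (S.1.restrict (c i.1 y i.2))).numGuesses i.1 : ℝ)⁻¹ :=
          sum_le_sum fun i _ => single_le_sum (f := fun S : Disks δ η =>
            ((G S y (S.1.restrict (c i.1 y i.2))).numGuesses i.1 : ℝ)⁻¹)
            (fun S _ => by positivity) (mem_univ (D y i.1 i.2))
      _ = ∑ S : Disks δ η, ∑ x : A, ∑ r : R,
            ((G S y (S.1.restrict (c x y r))).numGuesses x : ℝ)⁻¹ := by
          rw [sum_comm]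
          simp only [Fintype.sum_prod_type]
      _ ≤ ∑ S : Disks δ η, ∑ x : A, ∑ m : S.1 → Hint s, ((G S y m).numGuesses x : ℝ)⁻¹ := by
          refine sum_le_sum fun S _ => sum_le_sum fun x _ => ?_
          classical
          -- For fixed `x` and `S`, distinct `r` give distinct hints, so the sum over `r` is part of
          -- the sum over all hint vectors.
          rw [← sum_image (f := fun m => ((G S y m).numGuesses x : ℝ)⁻¹)
            (g := fun r => S.1.restrict (c x y r)) (fun r _ r' _ h => hc x y S h)]
          exact sum_le_sum_of_subset_of_nonneg (subset_univ _) fun m _ _ => by positivity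
      _ = ∑ S : Disks δ η, ∑ m : S.1 → Hint s, ∑ x : A, ((G S y m).numGuesses x : ℝ)⁻¹ :=
          sum_congr rfl fun S _ => sum_comm
      _ ≤ ∑ S : Disks δ η, ∑ m : S.1 → Hint s, (1 + Real.log (Fintype.card A)) :=
          sum_le_sum fun S _ => sum_le_sum fun m _ => GuessingFn.sum_inv_numGuesses_le _
      _ = ∑ S : Disks δ η, (((2 : ℝ) ^ s) ^ η * (1 + Real.log (Fintype.card A))) := by
          refine sum_congr rfl fun S _ => ?_
          rw [sum_const, card_univ, nsmul_eq_mul, Fintype.card_fun, Fintype.card_coe, S.2]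
          simp
      _ = _ := by
          rw [sum_const, card_univ, nsmul_eq_mul, Fintype.card_finset_len, Fintype.card_fin]
  refine le_trans (le_of_eq ?_) (sum_rpow_le_mul_sum_mul_rpow hρ
    (fun i : A × R => P i.1 y * (Fintype.card R : ℝ)⁻¹) (g y)
    (fun i => mul_nonneg (hP _ _) (inv_pos.mpr hR).le)
    (fun i => GuessingFn.numGuesses_pos _ _) hsum)
  have hT : 0 ≤ ∑ x, P x y ^ (1 / (1 + ρ)) := sum_nonneg fun x _ => Real.rpow_nonneg (hP x y) _
  -- Adjoining independent uniform randomness multiplies `renyiSum` by `|R| ^ ρ`.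
  have : ∑ i : A × R, (P i.1 y * (Fintype.card R : ℝ)⁻¹) ^ (1 / (1 + ρ))
      = (Fintype.card R : ℝ) ^ (ρ / (1 + ρ)) * ∑ x, P x y ^ (1 / (1 + ρ)) := by
    rw [Fintype.sum_prod_type, mul_sum]
    refine sum_congr rfl fun x _ => ?_
    change ∑ _r : R, (P x y * (Fintype.card R : ℝ)⁻¹) ^ (1 / (1 + ρ)) = _
    rw [sum_const, card_univ, nsmul_eq_mul, Real.mul_rpow (hP x y) (inv_pos.mpr hR).le,
      mul_left_comm, mul_comm, Real.inv_rpow hR.le, ← Real.rpow_neg hR.le]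
    congr 1
    nth_rewrite 1 [← Real.rpow_one (Fintype.card R : ℝ)]
    rw [← Real.rpow_add hR]
    congr 1
    field_simp
    ring
  rw [this, Real.mul_rpow (by positivity) hT, ← Real.rpow_mul hR.le, div_mul_cancel₀ _ h1.ne']

/-- A labelling of the source symbols such that few symbols have the label of `x`, if `x` is
guessed early. -/
theorem GuessingFn.exists_label (G : GuessingFn A) {K : ℕ} (hK : 0 < K) :
    ∃ f : A → Fin (Nat.log 2 (Fintype.card A) + 1) × Fin K, ∀ x,
      #{x' | f x' = f x} ≤ 2 * G.numGuesses x / K + 1 := by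
  have hlog : ∀ x, Nat.log 2 (G.numGuesses x) < Nat.log 2 (Fintype.card A) + 1 := fun x =>
    Nat.lt_succ_of_le (Nat.log_mono_right (G.numGuesses_le x))
  -- The label is the dyadic scale of the guess number together with its residue mod `K`. Equal
  -- scales bound the guess numbers in a class by twice that of `x`; equal residues make the
  -- quotient by `K` injective there.
  refine ⟨fun x => (⟨Nat.log 2 (G.numGuesses x), hlog x⟩, ⟨G.numGuesses x % K, Nat.mod_lt _ hK⟩),
    fun x => ?_⟩
  have key : ∀ x', x' ∈ ({x' | ((⟨Nat.log 2 (G.numGuesses x'), hlog x'⟩,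
      ⟨G.numGuesses x' % K, Nat.mod_lt _ hK⟩) :
        Fin (Nat.log 2 (Fintype.card A) + 1) × Fin K) = (⟨Nat.log 2 (G.numGuesses x), hlog x⟩,
      ⟨G.numGuesses x % K, Nat.mod_lt _ hK⟩)} : Finset A) →
      Nat.log 2 (G.numGuesses x') = Nat.log 2 (G.numGuesses x) ∧
        G.numGuesses x' % K = G.numGuesses x % K := by
    intro x' hx'
    simpa using hx'
  rw [← card_range (2 * G.numGuesses x / K + 1)]
  refine card_le_card_of_injOn (fun x' => G.numGuesses x' / K) (fun x' hx' => ?_)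
    fun x₁ h₁ x₂ h₂ h => ?_
  · obtain ⟨h, -⟩ := key x' hx'
    simp only [coe_range, Set.mem_Iio]
    refine Nat.lt_succ_of_le (Nat.div_le_div_right ?_)
    have h1 : G.numGuesses x' < 2 ^ (Nat.log 2 (G.numGuesses x') + 1) :=
      Nat.lt_pow_succ_log_self (by norm_num) _
    have h2 : 2 ^ Nat.log 2 (G.numGuesses x) ≤ G.numGuesses x :=
      Nat.pow_log_le_self 2 (Nat.succ_ne_zero _)
    rw [h, pow_succ] at h1
    omega
  · apply G.numGuesses_injective
    have e1 := (key x₁ h₁).2.trans (key x₂ h₂).2.symm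
    have h : G.numGuesses x₁ / K = G.numGuesses x₂ / K := h
    rw [← Nat.div_add_mod (G.numGuesses x₁) K, ← Nat.div_add_mod (G.numGuesses x₂) K, h, e1]

/-- A labelling with labels in a given set, and a bound on the powers of the sizes of its
classes. -/
theorem GuessingFn.exists_label_rpow_le {ρ : ℝ} (hρ : 0 < ρ) (G : GuessingFn A) {D : Type*}
    [Fintype D] [DecidableEq D] (hD : Nat.log 2 (Fintype.card A) + 1 ≤ Fintype.card D) :
    ∃ f : A → D, ∀ x, (#{x' | f x' = f x} : ℝ) ^ ρ ≤
      1 + (8 * (Nat.log 2 (Fintype.card A) + 1) / Fintype.card D) ^ ρ *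
        (G.numGuesses x : ℝ) ^ ρ := by
  set J := Nat.log 2 (Fintype.card A) + 1 with hJ
  set K := Fintype.card D / J with hK
  have hJ0 : 0 < J := Nat.succ_pos _
  have hK0 : 0 < K := Nat.div_pos hD hJ0
  obtain ⟨f, hf⟩ := G.exists_label hK0
  have hemb : Nonempty (Fin J × Fin K ↪ D) := by
    apply Function.Embedding.nonempty_of_card_le
    rw [Fintype.card_prod, Fintype.card_fin, Fintype.card_fin]
    exact Nat.mul_div_le _ _
  obtain ⟨e⟩ := hemb
  refine ⟨fun x => e (f x), fun x => ?_⟩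
  -- The rounding in `K = |D| / J` costs a factor of at most `2`.
  have hD2 : Fintype.card D ≤ 2 * (J * K) := by
    have h1 := Nat.div_add_mod (Fintype.card D) J
    have h2 := Nat.mod_lt (Fintype.card D) hJ0
    have h3 : J ≤ J * K := Nat.le_mul_of_pos_right _ hK0
    rw [← hK] at h1
    omega
  have hDpos : (0 : ℝ) < Fintype.card D := by exact_mod_cast hJ0.trans_le hD
  have hg := G.numGuesses_pos x
  rw [← Real.mul_rpow (by positivity) hg.le]
  simp only [e.injective.eq_iff]
  have hJc : (Nat.log 2 (Fintype.card A) + 1 : ℝ) = J := by rw [hJ]; push_cast; ring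
  rw [hJc]
  -- Symbols guessed early are alone in their class. For the others the `+ 1` in the class size is
  -- absorbed by doubling, which with `hD2` gives the constant `8`. The additive `1` of the bound
  -- must keep coefficient one, since Bob's ambiguity has to tend to `1`.
  by_cases hlt : 2 * G.numGuesses x < K
  · have h1 : #{x' | f x' = f x} ≤ 1 := by
      have := hf x
      rwa [Nat.div_eq_of_lt hlt, zero_add] at this
    calc (#{x' | f x' = f x} : ℝ) ^ ρ ≤ 1 :=
          Real.rpow_le_one (by positivity) (by exact_mod_cast h1) hρ.le
      _ ≤ _ := le_add_of_nonneg_right (by positivity)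
  · have h1 : #{x' | f x' = f x} * K ≤ 4 * G.numGuesses x := by
      have h2 := Nat.mul_le_mul_right K (hf x)
      have h3 := Nat.div_mul_le_self (2 * G.numGuesses x) K
      rw [add_mul] at h2
      omega
    have h2 : #{x' | f x' = f x} * Fintype.card D ≤ 8 * J * G.numGuesses x := by
      calc #{x' | f x' = f x} * Fintype.card D ≤ #{x' | f x' = f x} * (2 * (J * K)) := by gcongr
        _ = 2 * J * (#{x' | f x' = f x} * K) := by ring
        _ ≤ 2 * J * (4 * G.numGuesses x) := by gcongr
        _ = _ := by ring
    refine le_trans (Real.rpow_le_rpow (by positivity) ?_ hρ.le)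
      (le_add_of_nonneg_left zero_le_one)
    rw [div_mul_eq_mul_div, le_div_iff₀ hDpos]
    exact_mod_cast h2

/-- A code that stores labels in `D`, with local randomness in `R`, on `δ` disks of `s` bits, such
that any `ν` hints determine the label, and any `η` hints and the label determine the local
randomness. -/
structure IsHintCode {D R : Type*} (ν η : ℕ) (C : D → R → Fin δ → Hint s) : Prop where
  decode : ∀ S : Disks δ ν, ∀ d r d' r', S.1.restrict (C d r) = S.1.restrict (C d' r') → d = d'
  injective : ∀ d, ∀ S : Disks δ η, Function.Injective fun r => S.1.restrict (C d r)

/-- Encode the label of `x` in the optimal guessing order for `y`. Any `ν` hints determine the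
label, so Bob's list lies in the label class of `x`, and averaging the class sizes gives `renyiSum`.
-/
theorem exists_encoder {ρ : ℝ} (hρ : 0 < ρ) {η ν : ℕ} (hη : η ≤ δ) (hν : ν ≤ δ)
    {P : A → B → ℝ} (hP : ∀ x y, 0 ≤ P x y) (hP1 : ∑ x, ∑ y, P x y = 1)
    {D R : Type*} [Fintype D] [Fintype R] [Nonempty R] {C : D → R → Fin δ → Hint s}
    (hC : IsHintCode ν η C) (hD : Nat.log 2 (Fintype.card A) + 1 ≤ Fintype.card D) :
    ∃ W : Encoder A B δ s,
      bobListAmbiguity ρ ν P W ≤ 1 + (8 * (Nat.log 2 (Fintype.card A) + 1) / Fintype.card D) ^ ρ *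
        renyiSum ρ P ∧
      (Fintype.card R : ℝ) ^ ρ * renyiSum ρ P ≤
        (δ.choose η * (((2 : ℝ) ^ s) ^ η * (1 + Real.log (Fintype.card A)))) ^ ρ *
          eveAmbiguity ρ η P W := by
  classical
  obtain ⟨G, hG⟩ := exists_guessingFn_sum_le_renyiSum hρ hP
  choose f hf using fun y => (G y).exists_label_rpow_le hρ hD
  refine ⟨uniformEncoder fun x y => C (f y x), ?_,
    renyiSum_le_mul_eveAmbiguity hρ hη hP _ fun x y => hC.injective _⟩
  set Q : ℝ := (8 * (Nat.log 2 (Fintype.card A) + 1) / Fintype.card D) ^ ρ with hQ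
  have hne := nonempty_disks hν
  calc bobListAmbiguity ρ ν P (uniformEncoder fun x y => C (f y x))
      ≤ expect P (uniformEncoder fun x y => C (f y x)) (fun x y m =>
          1 + Q * ((G y).numGuesses x : ℝ) ^ ρ) := by
        refine expect_mono hP _ fun x y m _ hW => ciSup_le fun S => ?_
        refine le_trans (Real.rpow_le_rpow (by positivity) ?_ hρ.le) (hf y x)
        refine Nat.cast_le.mpr (card_le_card fun x' hx' => ?_)
        obtain ⟨m', hm', hne'⟩ := exists_of_mem_decodingList hx'
        obtain ⟨r', rfl⟩ := exists_of_uniformEncoder_ne_zero hne'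
        obtain ⟨r, rfl⟩ := exists_of_uniformEncoder_ne_zero
          (fun h0 => by rw [h0, ENNReal.toReal_zero] at hW; exact hW.false)
        exact mem_filter.mpr ⟨mem_univ _, hC.decode S _ _ _ _ hm'⟩
    _ = 1 + Q * ∑ x, ∑ y, P x y * ((G y).numGuesses x : ℝ) ^ ρ := by
        rw [expect_of_forall_eq P _ (fun x y => 1 + Q * ((G y).numGuesses x : ℝ) ^ ρ)]
        simp only [mul_add, sum_add_distrib, mul_one]
        rw [hP1]
        simp only [mul_sum]
        congr 1
        refine sum_congr rfl fun x _ => sum_congr rfl fun y _ => ?_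
        ring
    _ ≤ _ := by gcongr

end OneShot

/-! ### Reed–Solomon codes with random coefficients -/

section Code

/-- A polynomial of degree less than `n` is determined by its values at `n` distinct points
(Vandermonde). -/
theorem eq_of_forall_sum_pow_mul_eq {F : Type*} [Field F] {δ n : ℕ} (p : Fin δ ↪ F)
    (S : Finset (Fin δ)) (hS : S.card = n) {w w' : Fin n → F}
    (h : ∀ i ∈ S, ∑ j : Fin n, p i ^ (j : ℕ) * w j = ∑ j : Fin n, p i ^ (j : ℕ) * w' j) :
    w = w' := by
  rw [← sub_eq_zero]
  refine Matrix.eq_zero_of_forall_index_sum_pow_mul_eq_zero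
    (f := fun i => p (S.orderEmbOfFin hS i)) (p.injective.comp (S.orderEmbOfFin hS).injective)
    fun i => ?_
  simp only [Pi.sub_apply, mul_sub, sum_sub_distrib]
  rw [h _ (S.orderEmbOfFin_mem hS i), sub_self]

/-- Reed–Solomon codes whose coefficients are in part random. -/
theorem exists_isHintCode {δ s η ν a : ℕ} (hs : s ≠ 0) (hδ : δ ≤ 2 ^ s) (hην : η ≤ ν)
    (ha : a ≤ η * s) :
    ∃ C : Fin (2 ^ (ν * s - a)) → Fin (2 ^ a) → Fin δ → Hint s, IsHintCode ν η C := by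
  classical
  obtain ⟨k, rfl⟩ := Nat.exists_eq_add_of_le hην
  let F := GaloisField 2 s
  have hFc : Nat.card F = 2 ^ s := GaloisField.card 2 s hs
  have hfin : Finite F := Nat.finite_of_card_ne_zero (by rw [hFc]; positivity)
  have : Fintype F := Fintype.ofFinite F
  have hF : Fintype.card F = 2 ^ s := by rw [← Nat.card_eq_fintype_card, hFc]
  have e : F ≃ Hint s := Fintype.equivOfCardEq (by rw [hF]; simp)
  have hp : Nonempty (Fin δ ↪ F) :=
    Function.Embedding.nonempty_of_card_le (by rw [hF, Fintype.card_fin]; exact hδ)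
  obtain ⟨p⟩ := hp
  -- The `η` lowest coefficients hold the `a` random bits and `η * s - a` bits of the label; the `k
  -- = ν - η` highest hold the rest of the label.
  have hlow : Fintype.card (Fin (2 ^ (η * s - a)) × Fin (2 ^ a)) = Fintype.card (Fin η → F) := by
    rw [Fintype.card_prod, Fintype.card_fin, Fintype.card_fin, Fintype.card_fun, Fintype.card_fin,
      hF, ← pow_add, ← pow_mul, Nat.sub_add_cancel ha, mul_comm]
  have low := Fintype.equivOfCardEq hlow
  have hdata : Fintype.card (Fin (2 ^ ((η + k) * s - a)))
      = Fintype.card (Fin (2 ^ (η * s - a)) × (Fin k → F)) := by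
    rw [Fintype.card_prod, Fintype.card_fin, Fintype.card_fin, Fintype.card_fun, Fintype.card_fin,
      hF, ← pow_mul, ← pow_add]
    congr 1
    rw [add_mul, mul_comm s k]
    omega
  have data := Fintype.equivOfCardEq hdata
  let w (d : Fin (2 ^ ((η + k) * s - a))) (r : Fin (2 ^ a)) : Fin (η + k) → F :=
    Fin.append (low ((data d).1, r)) (data d).2
  refine ⟨fun d r i => e (∑ j : Fin (η + k), p i ^ (j : ℕ) * w d r j), ⟨?_, ?_⟩⟩
  · intro S d r d' r' h
    have hw : w d r = w d' r' := eq_of_forall_sum_pow_mul_eq p S.1 S.2 fun i hi =>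
      e.injective (congrFun h ⟨i, hi⟩)
    have h1 : low ((data d).1, r) = low ((data d').1, r') := by
      funext j
      simpa [w] using congrFun hw (Fin.castAdd k j)
    have h2 : (data d).2 = (data d').2 := by
      funext j
      simpa [w] using congrFun hw (Fin.natAdd η j)
    exact data.injective (Prod.ext (Prod.mk.inj (low.injective h1)).1 h2)
  -- For equal labels the highest coefficients cancel, which leaves polynomials of degree less than
  -- `η`, determined by `η` values.
  · intro d S r r' h
    have h1 : low ((data d).1, r) = low ((data d).1, r') :=
      eq_of_forall_sum_pow_mul_eq p S.1 S.2 fun i hi => by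
        have := e.injective (congrFun h ⟨i, hi⟩)
        simpa [w, Fin.sum_univ_add] using this
    exact congrArg Prod.snd (low.injective h1)

end Code

open Filter Topology

/-! ### Growth rates and limits in the extended reals -/

section Limits

theorem tendsto_logb_div_of_le_linear {u : ℕ → ℝ} (c : ℝ) (h1 : ∀ n, 1 ≤ u n)
    (hu : ∀ n : ℕ, u n ≤ c * (n + 1)) : Tendsto (fun n : ℕ => Real.logb 2 (u n) / n) atTop (𝓝 0) := by
  have hc : 0 < c := by
    have := (h1 0).trans (hu 0)
    norm_num at this
    linarith
  have hlim : Tendsto (fun n : ℕ => Real.logb 2 (2 * c) / n + Real.log n / n / Real.log 2) atTop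
      (𝓝 0) := by
    have h2 : Tendsto (fun n : ℕ => Real.log n / n) atTop (𝓝 0) := by
      have := (Real.tendsto_pow_log_div_mul_add_atTop 1 0 1 one_ne_zero).comp
        tendsto_natCast_atTop_atTop
      simpa [Function.comp_def] using this
    have := (tendsto_const_div_atTop_nhds_zero_nat (Real.logb 2 (2 * c))).add
      (h2.div_const (Real.log 2))
    simpa using this
  refine squeeze_zero' (Eventually.of_forall fun n => ?_) ?_ hlim
  · exact div_nonneg (Real.logb_nonneg one_lt_two (h1 n)) (Nat.cast_nonneg n)
  · filter_upwards [eventually_ge_atTop 1] with n hn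
    have hn' : (1 : ℝ) ≤ n := by exact_mod_cast hn
    have hle : u n ≤ 2 * c * n := (hu n).trans (by nlinarith)
    have hlog : Real.logb 2 (u n) ≤ Real.logb 2 (2 * c) + Real.logb 2 n := by
      rw [← Real.logb_mul (by positivity) (by positivity)]
      exact Real.logb_le_logb_of_le one_lt_two (zero_lt_one.trans_le (h1 n)) hle
    calc Real.logb 2 (u n) / n ≤ (Real.logb 2 (2 * c) + Real.logb 2 n) / n := by gcongr
      _ = _ := by
        rw [add_div, Real.logb, Real.logb, div_right_comm (Real.log n)]

theorem tendsto_floor_mul_div {R : ℝ} (hR : 0 ≤ R) :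
    Tendsto (fun n : ℕ => (⌊(n : ℝ) * R⌋₊ : ℝ) / n) atTop (𝓝 R) := by
  have := (tendsto_nat_floor_mul_div_atTop hR).comp (tendsto_natCast_atTop_atTop (R := ℝ))
  simpa [Function.comp_def, mul_comm] using this

theorem le_of_le_liminf_coe {u w : ℕ → ℝ} {E l : ℝ}
    (hE : (E : EReal) ≤ liminf (fun n => (u n : EReal)) atTop) (huw : ∀ᶠ n in atTop, u n ≤ w n)
    (hw : Tendsto w atTop (𝓝 l)) : E ≤ l := by
  have h1 : liminf (fun n => (u n : EReal)) atTop ≤ liminf (fun n => (w n : EReal)) atTop :=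
    liminf_le_liminf (huw.mono fun n hn => EReal.coe_le_coe_iff.mpr hn)
  rw [(EReal.tendsto_coe.mpr hw).liminf_eq] at h1
  exact EReal.coe_le_coe_iff.mp (hE.trans h1)

theorem coe_le_liminf_coe {u w : ℕ → ℝ} {l : ℝ} (huw : ∀ᶠ n in atTop, w n ≤ u n)
    (hw : Tendsto w atTop (𝓝 l)) : (l : EReal) ≤ liminf (fun n => (u n : EReal)) atTop := by
  rw [← (EReal.tendsto_coe.mpr hw).liminf_eq]
  exact liminf_le_liminf (huw.mono fun n hn => EReal.coe_le_coe_iff.mpr hn)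

theorem limsup_coe_le_coe {u w : ℕ → ℝ} {l : ℝ} (huw : ∀ᶠ n in atTop, u n ≤ w n)
    (hw : Tendsto w atTop (𝓝 l)) : limsup (fun n => (u n : EReal)) atTop ≤ l := by
  rw [← (EReal.tendsto_coe.mpr hw).limsup_eq]
  exact limsup_le_limsup (huw.mono fun n hn => EReal.coe_le_coe_iff.mpr hn)

end Limits

/-! ### Exponents: converse and direct part -/

section Asymptotic

set_option linter.unusedSectionVars false

variable {A B : Type*} [Fintype A] [Fintype B]

theorem logb_renyiSum {ρ : ℝ} (hρ : 0 < ρ) (P : A → B → ℝ) :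
    Real.logb 2 (renyiSum ρ P) = ρ * condRenyiEntropy (1 / (1 + ρ)) P := by
  have h1 : 0 < 1 + ρ := by positivity
  have h2 : 1 / (1 + ρ) / (1 - 1 / (1 + ρ)) = ρ⁻¹ := by
    have h3 : 1 - 1 / (1 + ρ) = ρ / (1 + ρ) := by
      field_simp
      ring
    rw [h3]
    field_simp
  rw [condRenyiEntropy, h2, renyiSum, one_div_one_div, mul_inv_cancel_left₀ hρ.ne']

theorem bobGuessAmbiguity_le_bobAmbiguity {ρ : ℝ} (hρ : 0 < ρ) {δ s ν : ℕ} (hν : ν ≤ δ)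
    {P : A → B → ℝ} (hP : ∀ x y, 0 ≤ P x y) (v : Version) (W : Encoder A B δ s) :
    bobGuessAmbiguity ρ ν P W ≤ bobAmbiguity v ρ ν P W := by
  cases v
  · exact le_rfl
  · exact bobGuessAmbiguity_le_bobListAmbiguity hρ hν hP W

theorem bobAmbiguity_le_bobListAmbiguity {ρ : ℝ} (hρ : 0 < ρ) {δ s ν : ℕ} (hν : ν ≤ δ)
    {P : A → B → ℝ} (hP : ∀ x y, 0 ≤ P x y) (v : Version) (W : Encoder A B δ s) :
    bobAmbiguity v ρ ν P W ≤ bobListAmbiguity ρ ν P W := by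
  cases v
  · exact bobGuessAmbiguity_le_bobListAmbiguity hρ hν hP W
  · exact le_rfl

/-- Eve's ambiguity for an arbitrary encoder, here one without disks, lies between `1` and
`renyiSum`. -/
theorem one_le_renyiSum {ρ : ℝ} (hρ : 0 < ρ) {P : A → B → ℝ} (hP : ∀ x y, 0 ≤ P x y)
    (hP1 : ∑ x, ∑ y, P x y = 1) : 1 ≤ renyiSum ρ P := by
  let W : Encoder A B 0 0 := fun _ _ => PMF.pure fun _ _ => false
  exact (one_le_eveAmbiguity hρ le_rfl hP hP1 W).trans (eveAmbiguity_le_renyiSum hρ le_rfl hP W)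

variable {P : (n : ℕ) → (Fin n → A) → (Fin n → B) → ℝ}

theorem tendsto_logb_one_add_log_card (A : Type*) [Fintype A] :
    Tendsto (fun n : ℕ => Real.logb 2 (1 + Real.log (Fintype.card (Fin n → A))) / n) atTop
      (𝓝 0) := by
  have h0 := Real.log_natCast_nonneg (Fintype.card A)
  have hlog : ∀ n : ℕ, Real.log (Fintype.card (Fin n → A)) = n * Real.log (Fintype.card A) := by
    intro n
    rw [Fintype.card_fun, Fintype.card_fin, Nat.cast_pow, Real.log_pow]
  refine tendsto_logb_div_of_le_linear (1 + Real.log (Fintype.card A)) (fun n => ?_) fun n => ?_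
  · exact le_add_of_nonneg_right (Real.log_natCast_nonneg _)
  · rw [hlog]
    have : (0 : ℝ) ≤ n := Nat.cast_nonneg n
    nlinarith

theorem tendsto_logb_natLog_card (A : Type*) [Fintype A] :
    Tendsto (fun n : ℕ => Real.logb 2 (8 * ((Nat.log 2 (Fintype.card (Fin n → A)) : ℝ) + 1)) / n)
      atTop (𝓝 0) := by
  have hlog : ∀ n : ℕ, Nat.log 2 (Fintype.card (Fin n → A)) ≤ Fintype.card A * n := by
    intro n
    rw [Fintype.card_fun, Fintype.card_fin]
    calc Nat.log 2 (Fintype.card A ^ n) ≤ Nat.log 2 ((2 ^ Fintype.card A) ^ n) :=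
          Nat.log_mono_right (Nat.pow_le_pow_left Nat.lt_two_pow_self.le n)
      _ = _ := by rw [← pow_mul, Nat.log_pow one_lt_two]
  refine tendsto_logb_div_of_le_linear (8 * (Fintype.card A + 1)) (fun n => ?_) fun n => ?_
  · have : (0 : ℝ) ≤ Nat.log 2 (Fintype.card (Fin n → A)) := Nat.cast_nonneg _
    linarith
  · have h1 : (Nat.log 2 (Fintype.card (Fin n → A)) : ℝ) ≤ Fintype.card A * n := by
      exact_mod_cast hlog n
    have h2 : (0 : ℝ) ≤ n := Nat.cast_nonneg n
    have h3 : (0 : ℝ) ≤ Fintype.card A := Nat.cast_nonneg _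
    nlinarith

theorem logb_two_pow_pow_rpow (s k : ℕ) (ρ : ℝ) :
    Real.logb 2 ((((2 : ℝ) ^ s) ^ k) ^ ρ) = ρ * (k * s) := by
  rw [← pow_mul, Real.logb_rpow_eq_mul_logb_of_pos (by positivity), Real.logb_pow,
    Real.logb_self_eq_one one_lt_two, mul_one, Nat.cast_mul, mul_comm (s : ℝ)]

/-- The converse. -/
theorem IsModestAchievable.bounds {ρ : ℝ} (hρ : 0 < ρ) {δ ν η : ℕ} (hνδ : ν ≤ δ) (hην : η ≤ ν)
    {H : ℝ} (hP : ∀ n x y, 0 ≤ P n x y) (hP1 : ∀ n, ∑ x, ∑ y, P n x y = 1)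
    (hz : Tendsto (fun n : ℕ => Real.logb 2 (renyiSum ρ (P n)) / n) atTop (𝓝 (ρ * H)))
    {Rs : ℝ} (hRs : 0 ≤ Rs) {v : Version} {EB E : ℝ}
    (h : IsModestAchievable v ρ δ ν η Rs P EB E) :
    E ≤ ρ * H ∧ E ≤ ρ * Rs * ((ν : ℝ) - η) + EB ∧ ρ * H ≤ ρ * (ν * Rs) + EB := by
  obtain ⟨W, hB, hE⟩ := h
  have hs := tendsto_floor_mul_div hRs
  -- The bound on the limsup yields eventual inequalities only up to `ε`, which is removed at the
  -- end of each estimate.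
  have hBob : ∀ ε : ℝ, 0 < ε → ∀ᶠ n : ℕ in atTop,
      Real.logb 2 (bobGuessAmbiguity ρ ν (P n) (W n)) / n ≤ EB + ε := by
    intro ε hε
    have hlt : limsup (fun n : ℕ =>
        ((Real.logb 2 (bobAmbiguity v ρ ν (P n) (W n)) / n : ℝ) : EReal)) atTop
        < ((EB + ε : ℝ) : EReal) := hB.trans_lt (EReal.coe_lt_coe_iff.mpr (by linarith))
    filter_upwards [eventually_lt_of_limsup_lt hlt] with n hn
    have h1 := one_le_bobGuessAmbiguity hρ hνδ (hP n) (hP1 n) (W n)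
    refine le_trans ?_ (EReal.coe_lt_coe_iff.mp hn).le
    refine div_le_div_of_nonneg_right ?_ (Nat.cast_nonneg n)
    exact Real.logb_le_logb_of_le one_lt_two (by linarith)
      (bobGuessAmbiguity_le_bobAmbiguity hρ hνδ (hP n) v (W n))
  refine ⟨?_, ?_, ?_⟩
  · refine le_of_le_liminf_coe hE (Eventually.of_forall fun n => ?_) hz
    have h1 := one_le_eveAmbiguity hρ (hην.trans hνδ) (hP n) (hP1 n) (W n)
    refine div_le_div_of_nonneg_right ?_ (Nat.cast_nonneg n)
    exact Real.logb_le_logb_of_le one_lt_two (by linarith)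
      (eveAmbiguity_le_renyiSum hρ (hην.trans hνδ) (hP n) (W n))
  · refine le_of_forall_pos_le_add fun ε hε => ?_
    have hlim := ((hs.const_mul (ρ * ((ν : ℝ) - η))).add_const (EB + ε))
    refine (le_of_le_liminf_coe hE ?_ hlim).trans_eq (by ring)
    filter_upwards [hBob ε hε] with n hn
    have h1 := one_le_eveAmbiguity hρ (hην.trans hνδ) (hP n) (hP1 n) (W n)
    have h2 := one_le_bobGuessAmbiguity hρ hνδ (hP n) (hP1 n) (W n)
    have h3 := Real.logb_le_logb_of_le one_lt_two (by linarith)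
      (eveAmbiguity_le_mul_bobGuessAmbiguity hρ hην hνδ (hP n) (W n))
    rw [Real.logb_mul (by positivity) (by positivity), logb_two_pow_pow_rpow,
      Nat.cast_sub hην] at h3
    calc _ ≤ (ρ * (((ν : ℝ) - η) * hintBits Rs n)
          + Real.logb 2 (bobGuessAmbiguity ρ ν (P n) (W n))) / n := by gcongr
      _ = ρ * ((ν : ℝ) - η) * (hintBits Rs n / n)
          + Real.logb 2 (bobGuessAmbiguity ρ ν (P n) (W n)) / n := by ring
      _ ≤ _ := by gcongr
  · refine le_of_forall_pos_le_add fun ε hε => ?_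
    have hlim := (((tendsto_logb_one_add_log_card A).const_mul ρ).add
      (hs.const_mul (ρ * ν))).add_const (EB + ε)
    refine (le_of_tendsto_of_tendsto hz hlim ?_).trans_eq (by ring)
    filter_upwards [hBob ε hε] with n hn
    have h0 := one_add_log_card_pos (Fin n → A)
    have h1 := one_le_renyiSum hρ (hP n) (hP1 n)
    have h2 := one_le_bobGuessAmbiguity hρ hνδ (hP n) (hP1 n) (W n)
    have h3 := Real.logb_le_logb_of_le one_lt_two (by linarith)
      (renyiSum_le_mul_bobGuessAmbiguity hρ hνδ (hP n) (W n))
    rw [Real.logb_mul (by positivity) (by positivity), Real.logb_mul (by positivity) (by positivity),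
      logb_two_pow_pow_rpow, Real.logb_rpow_eq_mul_logb_of_pos h0] at h3
    calc _ ≤ (ρ * Real.logb 2 (1 + Real.log (Fintype.card (Fin n → A)))
          + (ρ * (ν * hintBits Rs n) + Real.logb 2 (bobGuessAmbiguity ρ ν (P n) (W n)))) / n := by
          gcongr
      _ = ρ * (Real.logb 2 (1 + Real.log (Fintype.card (Fin n → A))) / n)
          + ρ * ν * (hintBits Rs n / n)
          + Real.logb 2 (bobGuessAmbiguity ρ ν (P n) (W n)) / n := by ring
      _ ≤ _ := by gcongr

/-- Lets the case `EB = 0` of the modest converse serve for the privacy-exponent. -/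
theorem IsAchievable.isModestAchievable {v : Version} {ρ : ℝ} {δ ν η : ℕ} {Rs E : ℝ}
    (h : IsAchievable v ρ δ ν η Rs P E) : IsModestAchievable v ρ δ ν η Rs P 0 E := by
  obtain ⟨W, hB, hE⟩ := h
  refine ⟨W, ?_, hE⟩
  refine limsup_coe_le_coe (Eventually.of_forall fun n => le_rfl) ?_
  have h1 : Tendsto (fun n => Real.logb 2 (bobAmbiguity v ρ ν (P n) (W n))) atTop (𝓝 0) := by
    have := (hB.log one_ne_zero).div_const (Real.log 2)
    simpa [Real.logb] using this
  exact h1.div_atTop tendsto_natCast_atTop_atTop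

/-- The exponential form of `renyiSum_le_mul_eveAmbiguity` with `a n` bits of local randomness: the
binomial coefficient is constant and the harmonic factor is linear in `n`, so neither contributes.
-/
theorem coe_le_liminf_logb_eveAmbiguity {ρ : ℝ} (hρ : 0 < ρ) {δ η : ℕ} (hη : η ≤ δ)
    {H : ℝ} (hP : ∀ n x y, 0 ≤ P n x y) (hP1 : ∀ n, ∑ x, ∑ y, P n x y = 1)
    (hz : Tendsto (fun n : ℕ => Real.logb 2 (renyiSum ρ (P n)) / n) atTop (𝓝 (ρ * H)))
    {Rs : ℝ} (hRs : 0 ≤ Rs) (W : EncoderSeq A B δ Rs) {a : ℕ → ℕ} {α : ℝ}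
    (ha : Tendsto (fun n => (a n : ℝ) / n) atTop (𝓝 α))
    (hW : ∀ᶠ n in atTop, ((2 : ℝ) ^ a n) ^ ρ * renyiSum ρ (P n) ≤
      (δ.choose η * (((2 : ℝ) ^ hintBits Rs n) ^ η *
        (1 + Real.log (Fintype.card (Fin n → A))))) ^ ρ * eveAmbiguity ρ η (P n) (W n)) :
    ((ρ * (α + H - η * Rs) : ℝ) : EReal) ≤ liminf
      (fun n : ℕ => ((Real.logb 2 (eveAmbiguity ρ η (P n) (W n)) / n : ℝ) : EReal)) atTop := by
  have hs := tendsto_floor_mul_div hRs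
  have hchoose := tendsto_const_div_atTop_nhds_zero_nat (Real.logb 2 (δ.choose η))
  have hlim := ((ha.const_mul ρ).add hz).sub
    (((hchoose.add (hs.const_mul (η : ℝ))).add (tendsto_logb_one_add_log_card A)).const_mul ρ)
  have hlim' : ρ * α + ρ * H - ρ * (0 + η * Rs + 0) = ρ * (α + H - η * Rs) := by ring
  rw [hlim'] at hlim
  refine coe_le_liminf_coe ?_ hlim
  filter_upwards [hW] with n hn
  have h0 := one_add_log_card_pos (Fin n → A)
  have h1 := one_le_renyiSum hρ (hP n) (hP1 n)
  have h2 := one_le_eveAmbiguity hρ hη (hP n) (hP1 n) (W n)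
  have hC : (0 : ℝ) < δ.choose η := by exact_mod_cast Nat.choose_pos hη
  have h3 := Real.logb_le_logb_of_le one_lt_two (by positivity) hn
  rw [Real.logb_mul (by positivity) (by positivity), Real.logb_mul (by positivity) (by positivity),
    Real.logb_rpow_eq_mul_logb_of_pos (by positivity),
    Real.logb_rpow_eq_mul_logb_of_pos (by positivity),
    Real.logb_mul (by positivity) (by positivity), Real.logb_mul (by positivity) (by positivity),
    ← pow_mul, Real.logb_pow, Real.logb_pow, Real.logb_self_eq_one one_lt_two, mul_one, mul_one,
    Nat.cast_mul] at h3
  have h4 : (ρ * a n + Real.logb 2 (renyiSum ρ (P n)) - ρ * (Real.logb 2 (δ.choose η) +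
      (hintBits Rs n * η + Real.logb 2 (1 + Real.log (Fintype.card (Fin n → A)))))) / n
      ≤ Real.logb 2 (eveAmbiguity ρ η (P n) (W n)) / n := by
    gcongr
    linarith
  exact le_trans (le_of_eq (by ring)) h4

/-- The direct part: `α` is the rate of the local randomness of the encoder. -/
theorem exists_encoderSeq {ρ : ℝ} (hρ : 0 < ρ) {δ ν η : ℕ} (hνδ : ν ≤ δ) (hην : η < ν)
    {H : ℝ} (hP : ∀ n x y, 0 ≤ P n x y) (hP1 : ∀ n, ∑ x, ∑ y, P n x y = 1)
    (hz : Tendsto (fun n : ℕ => Real.logb 2 (renyiSum ρ (P n)) / n) atTop (𝓝 (ρ * H)))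
    {Rs : ℝ} (hRs : 0 < Rs) {α : ℝ} (hα0 : 0 ≤ α) (hα : α ≤ η * Rs) :
    ∃ (W : EncoderSeq A B δ Rs) (T : ℕ → ℝ), (∀ n, 0 < T n) ∧
      Tendsto (fun n => Real.logb 2 (T n) / n) atTop (𝓝 (ρ * (H - (ν * Rs - α)))) ∧
      (∀ᶠ n in atTop, bobListAmbiguity ρ ν (P n) (W n) ≤ 1 + T n) ∧
      ((ρ * (α + H - η * Rs) : ℝ) : EReal) ≤ liminf
        (fun n : ℕ => ((Real.logb 2 (eveAmbiguity ρ η (P n) (W n)) / n : ℝ) : EReal)) atTop := by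
  classical
  have hs := tendsto_floor_mul_div hRs.le
  have hηs := hs.const_mul (η : ℝ)
  -- The minimum enforces `a n ≤ η * s`, which can fail for `⌊n * α⌋₊` because of rounding even
  -- though `α ≤ η * Rs`; the rate remains `α`.
  let a (n : ℕ) : ℕ := min ⌊(n : ℝ) * α⌋₊ (η * hintBits Rs n)
  have ha_le : ∀ n, a n ≤ η * hintBits Rs n := fun n => min_le_right _ _
  have ha : Tendsto (fun n => (a n : ℝ) / n) atTop (𝓝 α) := by
    have h1 := (tendsto_floor_mul_div hα0).min hηs
    rw [min_eq_left hα] at h1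
    refine h1.congr fun n => ?_
    simp only [a]
    rw [Nat.cast_min, Nat.cast_mul, ← mul_div_assoc, min_div_div_right (Nat.cast_nonneg n)]
  have haν : ∀ n, a n ≤ ν * hintBits Rs n := fun n =>
    (ha_le n).trans (Nat.mul_le_mul_right _ hην.le)
  let b (n : ℕ) : ℕ := ν * hintBits Rs n - a n
  have hb : Tendsto (fun n => (b n : ℝ) / n) atTop (𝓝 (ν * Rs - α)) := by
    refine ((hs.const_mul (ν : ℝ)).sub ha).congr fun n => ?_
    simp only [b]
    rw [Nat.cast_sub (haν n), sub_div, Nat.cast_mul, mul_div_assoc]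
  -- The label rate is positive, so `2 ^ b n` eventually exceeds the linear number of dyadic scales
  -- required by the labelling.
  have hκ : 0 < ν * Rs - α := by
    have : (η : ℝ) < ν := by exact_mod_cast hην
    nlinarith
  have hs_top : Tendsto (fun n => hintBits Rs n) atTop atTop :=
    tendsto_nat_floor_atTop.comp (tendsto_natCast_atTop_atTop.atTop_mul_const hRs)
  have hJ := tendsto_logb_natLog_card A
  -- eventually the labels fit
  have hfit : ∀ᶠ n in atTop, Nat.log 2 (Fintype.card (Fin n → A)) + 1 ≤ 2 ^ b n := by
    filter_upwards [hJ.eventually_lt hb hκ, eventually_gt_atTop 0] with n hn hn0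
    have hn0' : (0 : ℝ) < n := by exact_mod_cast hn0
    rw [div_lt_div_iff_of_pos_right hn0'] at hn
    have h1 := (Real.logb_lt_iff_lt_rpow one_lt_two (by positivity)).mp hn
    rw [Real.rpow_natCast] at h1
    have h2 : (Nat.log 2 (Fintype.card (Fin n → A)) + 1 : ℝ) ≤ 2 ^ b n := by
      have : (0 : ℝ) ≤ Nat.log 2 (Fintype.card (Fin n → A)) := Nat.cast_nonneg _
      linarith
    exact_mod_cast h2
  let T (n : ℕ) : ℝ := (8 * (Nat.log 2 (Fintype.card (Fin n → A)) + 1) / (2 : ℝ) ^ b n) ^ ρ *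
    renyiSum ρ (P n)
  -- At the blocklengths too small for the code or the labels, the encoder is arbitrary.
  have hex : ∀ n, ∃ W : Encoder (Fin n → A) (Fin n → B) δ (hintBits Rs n),
      hintBits Rs n ≠ 0 → δ ≤ 2 ^ hintBits Rs n →
      Nat.log 2 (Fintype.card (Fin n → A)) + 1 ≤ 2 ^ b n →
      bobListAmbiguity ρ ν (P n) W ≤ 1 + T n ∧
      ((2 : ℝ) ^ a n) ^ ρ * renyiSum ρ (P n) ≤
        (δ.choose η * (((2 : ℝ) ^ hintBits Rs n) ^ η *
          (1 + Real.log (Fintype.card (Fin n → A))))) ^ ρ * eveAmbiguity ρ η (P n) W := by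
    intro n
    by_cases h : hintBits Rs n ≠ 0 ∧ δ ≤ 2 ^ hintBits Rs n ∧
      Nat.log 2 (Fintype.card (Fin n → A)) + 1 ≤ 2 ^ b n
    · obtain ⟨h1, h2, h3⟩ := h
      obtain ⟨C, hC⟩ := exists_isHintCode h1 h2 hην.le (ha_le n)
      have : Nonempty (Fin (2 ^ a n)) := ⟨⟨0, by positivity⟩⟩
      obtain ⟨W, hW1, hW2⟩ := exists_encoder hρ (hην.le.trans hνδ) hνδ (hP n) (hP1 n) hC
        (by rw [Fintype.card_fin]; exact h3)
      refine ⟨W, fun _ _ _ => ⟨?_, ?_⟩⟩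
      · rw [Fintype.card_fin] at hW1
        simpa [T] using hW1
      · rw [Fintype.card_fin] at hW2
        simpa using hW2
    · exact ⟨fun _ _ => PMF.pure fun _ _ => false, fun h1 h2 h3 => absurd ⟨h1, h2, h3⟩ h⟩
  choose W hW using hex
  have hgood : ∀ᶠ n in atTop, hintBits Rs n ≠ 0 ∧ δ ≤ 2 ^ hintBits Rs n := by
    filter_upwards [hs_top.eventually_ge_atTop (δ + 1)] with n hn
    exact ⟨by omega, (by omega : δ ≤ hintBits Rs n).trans Nat.lt_two_pow_self.le⟩
  refine ⟨W, T, fun n => ?_, ?_, ?_, ?_⟩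
  · have := one_le_renyiSum hρ (hP n) (hP1 n)
    positivity
  · have hlim := ((hJ.sub hb).const_mul ρ).add hz
    have e : ρ * (0 - (ν * Rs - α)) + ρ * H = ρ * (H - (ν * Rs - α)) := by ring
    rw [e] at hlim
    refine hlim.congr fun n => ?_
    have := one_le_renyiSum hρ (hP n) (hP1 n)
    have hTn : Real.logb 2 (T n) = ρ * (Real.logb 2 (8 * (Nat.log 2 (Fintype.card (Fin n → A)) + 1))
        - b n) + Real.logb 2 (renyiSum ρ (P n)) := by
      simp only [T]
      rw [Real.logb_mul (by positivity) (by positivity),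
        Real.logb_rpow_eq_mul_logb_of_pos (by positivity),
        Real.logb_div (by positivity) (by positivity), Real.logb_pow,
        Real.logb_self_eq_one one_lt_two, mul_one]
    rw [hTn]
    ring
  · filter_upwards [hgood, hfit] with n h1 h2
    exact (hW n h1.1 h1.2 h2).1
  · refine coe_le_liminf_logb_eveAmbiguity hρ (hην.le.trans hνδ) hP hP1 hz hRs.le W ha ?_
    filter_upwards [hgood, hfit] with n h1 h2
    exact (hW n h1.1 h1.2 h2).2

theorem isModestAchievable_of_pos {ρ : ℝ} (hρ : 0 < ρ) {δ ν η : ℕ} (hνδ : ν ≤ δ) (hην : η < ν)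
    {H : ℝ} (hP : ∀ n x y, 0 ≤ P n x y) (hP1 : ∀ n, ∑ x, ∑ y, P n x y = 1)
    (hz : Tendsto (fun n : ℕ => Real.logb 2 (renyiSum ρ (P n)) / n) atTop (𝓝 (ρ * H)))
    {Rs : ℝ} (hRs : 0 < Rs) (v : Version) {EB : ℝ} (hEB : 0 ≤ EB) (h : H - ρ⁻¹ * EB ≤ ν * Rs) :
    IsModestAchievable v ρ δ ν η Rs P EB (min (ρ * Rs * ((ν : ℝ) - η) + EB) (ρ * H)) := by
  -- The second term is the randomness rate at which the exponent `ρ * (H - (ν * Rs - α))` of `T`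
  -- equals `EB`; the first is the largest rate that the code allows.
  set α := min (η * Rs) (ν * Rs - (H - ρ⁻¹ * EB)) with hα
  obtain ⟨W, T, hT0, hT, hB, hE⟩ := exists_encoderSeq hρ hνδ hην hP hP1 hz hRs (α := α)
    (le_min (by positivity) (by linarith)) (min_le_left _ _)
  refine ⟨W, ?_, le_trans (EReal.coe_le_coe_iff.mpr (le_of_eq ?_)) hE⟩
  · have hlim := (tendsto_const_div_atTop_nhds_zero_nat (1 : ℝ)).add
      ((tendsto_const_nhds (x := (0 : ℝ))).max hT)
    have hle : 0 + max 0 (ρ * (H - (ν * Rs - α))) ≤ EB := by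
      rw [zero_add]
      refine max_le hEB ?_
      have h1 : H - (ν * Rs - α) ≤ ρ⁻¹ * EB := by
        have := min_le_right (η * Rs) (ν * Rs - (H - ρ⁻¹ * EB))
        linarith
      calc ρ * (H - (ν * Rs - α)) ≤ ρ * (ρ⁻¹ * EB) := by gcongr
        _ = EB := mul_inv_cancel_left₀ hρ.ne' EB
    refine le_trans (limsup_coe_le_coe ?_ hlim) (EReal.coe_le_coe_iff.mpr hle)
    filter_upwards [hB] with n hn
    have h1 : (1 : ℝ) ≤ bobAmbiguity v ρ ν (P n) (W n) :=
      (one_le_bobGuessAmbiguity hρ hνδ (hP n) (hP1 n) (W n)).trans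
        (bobGuessAmbiguity_le_bobAmbiguity hρ hνδ (hP n) v (W n))
    have h2 : bobAmbiguity v ρ ν (P n) (W n) ≤ 2 * max 1 (T n) := by
      refine (bobAmbiguity_le_bobListAmbiguity hρ hνδ (hP n) v (W n)).trans (hn.trans ?_)
      have := le_max_left 1 (T n)
      have := le_max_right 1 (T n)
      linarith
    have h3 : Real.logb 2 (max 1 (T n)) = max 0 (Real.logb 2 (T n)) := by
      rcases le_total 1 (T n) with h | h
      · rw [max_eq_right h, max_eq_right (Real.logb_nonneg one_lt_two h)]
      · rw [max_eq_left h, Real.logb_one,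
          max_eq_left (Real.logb_nonpos one_lt_two (hT0 n).le h)]
    have h4 := Real.logb_le_logb_of_le one_lt_two (by linarith) h2
    rw [Real.logb_mul two_ne_zero (by positivity), Real.logb_self_eq_one one_lt_two, h3] at h4
    calc _ ≤ (1 + max 0 (Real.logb 2 (T n))) / n := by gcongr
      _ = _ := by
        rw [add_div, ← max_div_div_right (Nat.cast_nonneg n), zero_div]
  · have h1 : α + H - η * Rs = min H (Rs * ((ν : ℝ) - η) + ρ⁻¹ * EB) := by
      rw [hα, add_sub_assoc, ← min_add_add_right]
      congr 1 <;> ring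
    rw [h1, mul_min_of_nonneg _ _ hρ.le, mul_add, mul_inv_cancel_left₀ hρ.ne', min_comm, mul_assoc]

/-- At rate zero the hints are empty, so Bob and Eve both guess without help at exponent `ρ * H`.
The list version is excluded: without hints Bob's list is the whole conditional support, whose
growth `H` does not control. -/
theorem isModestAchievable_of_eq_zero {ρ : ℝ} (hρ : 0 < ρ) {δ ν η : ℕ} (hνδ : ν ≤ δ) (hην : η < ν)
    {H : ℝ} (hP : ∀ n x y, 0 ≤ P n x y) (hP1 : ∀ n, ∑ x, ∑ y, P n x y = 1)
    (hz : Tendsto (fun n : ℕ => Real.logb 2 (renyiSum ρ (P n)) / n) atTop (𝓝 (ρ * H)))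
    {EB : ℝ} (h : ρ * H ≤ EB) :
    IsModestAchievable Version.guessing ρ δ ν η 0 P EB (ρ * H) := by
  let c (n : ℕ) (_ : Fin n → A) (_ : Fin n → B) (_ : Unit) : Fin δ → Hint (hintBits 0 n) :=
    fun _ _ => false
  refine ⟨fun n => uniformEncoder (c n), ?_, ?_⟩
  · refine le_trans (limsup_coe_le_coe (Eventually.of_forall fun n => ?_) hz)
      (EReal.coe_le_coe_iff.mpr h)
    have h1 := one_le_bobGuessAmbiguity hρ hνδ (hP n) (hP1 n) (uniformEncoder (c n))
    refine div_le_div_of_nonneg_right ?_ (Nat.cast_nonneg n)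
    exact Real.logb_le_logb_of_le one_lt_two (zero_lt_one.trans_le h1)
      (bobGuessAmbiguity_le_renyiSum hρ hνδ (hP n) _)
  · have ha : Tendsto (fun n : ℕ => (((fun _ => 0 : ℕ → ℕ) n : ℕ) : ℝ) / n) atTop (𝓝 0) := by simp
    have := coe_le_liminf_logb_eveAmbiguity hρ (hην.le.trans hνδ) hP hP1 hz le_rfl
      (fun n => uniformEncoder (c n)) ha (Eventually.of_forall fun n => by
        simpa using renyiSum_le_mul_eveAmbiguity hρ (hην.le.trans hνδ) (hP n) (c n)
          fun x y S => Function.injective_of_subsingleton _)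
    simpa using this

theorem isAchievable_of_lt {ρ : ℝ} (hρ : 0 < ρ) {δ ν η : ℕ} (hνδ : ν ≤ δ) (hην : η < ν)
    {H : ℝ} (hP : ∀ n x y, 0 ≤ P n x y) (hP1 : ∀ n, ∑ x, ∑ y, P n x y = 1)
    (hz : Tendsto (fun n : ℕ => Real.logb 2 (renyiSum ρ (P n)) / n) atTop (𝓝 (ρ * H)))
    {Rs : ℝ} (hRs : 0 < Rs) (v : Version) {ε : ℝ} (hε : 0 < ε) (h : ε ≤ ν * Rs - H) :
    IsAchievable v ρ δ ν η Rs P (ρ * min (Rs * ((ν : ℝ) - η) - ε) H) := by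
  -- The slack `ε` makes the exponent of `T` at most `-ρ * ε`, so `T` tends to `0` and Bob's
  -- ambiguity to `1`.
  set α := min (η * Rs) (ν * Rs - H - ε) with hα
  obtain ⟨W, T, hT0, hT, hB, hE⟩ := exists_encoderSeq hρ hνδ hην hP hP1 hz hRs (α := α)
    (le_min (by positivity) (by linarith)) (min_le_left _ _)
  refine ⟨W, ?_, le_trans (EReal.coe_le_coe_iff.mpr (le_of_eq ?_)) hE⟩
  · have hneg : ρ * (H - (ν * Rs - α)) < 0 := by
      have := min_le_right (η * Rs) (ν * Rs - H - ε)
      exact mul_neg_of_pos_of_neg hρ (by linarith)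
    have hlog : Tendsto (fun n => Real.logb 2 (T n)) atTop atBot := by
      refine (hT.neg_mul_atTop hneg tendsto_natCast_atTop_atTop).congr' ?_
      filter_upwards [eventually_gt_atTop 0] with n hn
      exact div_mul_cancel₀ _ (by positivity)
    have hT_lim : Tendsto T atTop (𝓝 0) := by
      refine ((tendsto_rpow_atBot_of_base_gt_one 2 one_lt_two).comp hlog).congr fun n => ?_
      exact Real.rpow_logb two_pos one_lt_two.ne' (hT0 n)
    have hlim : Tendsto (fun n => 1 + T n) atTop (𝓝 1) := by simpa using hT_lim.const_add 1
    refine tendsto_of_tendsto_of_tendsto_of_le_of_le' tendsto_const_nhds hlim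
      (Eventually.of_forall fun n => ?_) ?_
    · exact (one_le_bobGuessAmbiguity hρ hνδ (hP n) (hP1 n) (W n)).trans
        (bobGuessAmbiguity_le_bobAmbiguity hρ hνδ (hP n) v (W n))
    · filter_upwards [hB] with n hn
      exact (bobAmbiguity_le_bobListAmbiguity hρ hνδ (hP n) v (W n)).trans hn
  · have h1 : α + H - η * Rs = min H (Rs * ((ν : ℝ) - η) - ε) := by
      rw [hα, add_sub_assoc, ← min_add_add_right]
      congr 1 <;> ring
    rw [h1, min_comm]

end Asymptotic

/-! ### The block distributions have total mass one -/

section BlockPMF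

open MeasureTheory

variable {Ω A B : Type*} [MeasurableSpace Ω] (μ : Measure Ω) [IsProbabilityMeasure μ]
  [Fintype A] [MeasurableSpace A] [DiscreteMeasurableSpace A]
  [Fintype B] [MeasurableSpace B] [DiscreteMeasurableSpace B]

theorem sum_blockPMF {X : ℕ → Ω → A} {Y : ℕ → Ω → B}
    (hX : ∀ i, Measurable (X i)) (hY : ∀ i, Measurable (Y i)) (n : ℕ) :
    ∑ x, ∑ y, blockPMF μ X Y n x y = 1 := by
  let S (p : (Fin n → A) × (Fin n → B)) : Set Ω :=
    {ω | (∀ i : Fin n, X i ω = p.1 i) ∧ (∀ i : Fin n, Y i ω = p.2 i)}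
  have hS : ∀ p, MeasurableSet (S p) := by
    intro p
    refine MeasurableSet.inter (s₁ := {ω | ∀ i : Fin n, X i ω = p.1 i})
      (s₂ := {ω | ∀ i : Fin n, Y i ω = p.2 i}) ?_ ?_
    · simp only [Set.ofPred_forall]
      exact MeasurableSet.iInter fun i => hX i (MeasurableSet.of_discrete (s := {p.1 i}))
    · simp only [Set.ofPred_forall]
      exact MeasurableSet.iInter fun i => hY i (MeasurableSet.of_discrete (s := {p.2 i}))
  have hdisj : Pairwise (Function.onFun Disjoint S) := by
    intro p q hpq
    refine Set.disjoint_left.mpr fun ω hp hq => hpq (Prod.ext (funext fun i => ?_)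
      (funext fun i => ?_))
    · exact (hp.1 i).symm.trans (hq.1 i)
    · exact (hp.2 i).symm.trans (hq.2 i)
  have hU : ⋃ p, S p = Set.univ := by
    refine Set.eq_univ_of_forall fun ω => Set.mem_iUnion.mpr
      ⟨(fun i => X i ω, fun i => Y i ω), fun i => rfl, fun i => rfl⟩
  have h := measureReal_iUnion_fintype (μ := μ) hdisj hS
  rw [hU, probReal_univ, Fintype.sum_prod_type] at h
  exact h.symm

end BlockPMF

end DiskFailure

/-! ### Assembly of the converse and the direct part -/

theorem mainTheorem9
    {Ω A B : Type*} [MeasurableSpace Ω] (μ : MeasureTheory.Measure Ω)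
    [MeasureTheory.IsProbabilityMeasure μ]
    [Fintype A] [MeasurableSpace A] [DiscreteMeasurableSpace A]
    [Fintype B] [MeasurableSpace B] [DiscreteMeasurableSpace B]
    (X : ℕ → Ω → A) (Y : ℕ → Ω → B)
    (hX : ∀ i, Measurable (X i)) (hY : ∀ i, Measurable (Y i))
    (ρ : ℝ) (hρ : 0 < ρ)
    (δ ν η : ℕ) (hνδ : ν ≤ δ) (hην : η < ν)
    (H : ℝ)
    (hH : Filter.Tendsto
      (fun n : ℕ =>
        DiskFailure.condRenyiEntropy (1 / (1 + ρ)) (DiskFailure.blockPMF μ X Y n) / n)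
      Filter.atTop (nhds H))
    (Rs : ℝ) (hRs : 0 ≤ Rs) (v : DiskFailure.Version) :
    (H < ν * Rs →
      DiskFailure.privacyExponent v ρ δ ν η Rs (DiskFailure.blockPMF μ X Y)
        = ((ρ * min (Rs * ((ν : ℝ) - η)) H : ℝ) : EReal)) ∧
    (ν * Rs < H →
      DiskFailure.privacyExponent v ρ δ ν η Rs (DiskFailure.blockPMF μ X Y) = ⊥) ∧
    (∀ EB : ℝ, 0 ≤ EB →
      (H - ρ⁻¹ * EB ≤ ν * Rs → (v = DiskFailure.Version.list → 0 < Rs) →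
        DiskFailure.modestPrivacyExponent v ρ δ ν η Rs (DiskFailure.blockPMF μ X Y) EB
          = ((min (ρ * Rs * ((ν : ℝ) - η) + EB) (ρ * H) : ℝ) : EReal)) ∧
      (ν * Rs < H - ρ⁻¹ * EB →
        DiskFailure.modestPrivacyExponent v ρ δ ν η Rs (DiskFailure.blockPMF μ X Y) EB = ⊥)) := by
  have hP : ∀ n x y, 0 ≤ DiskFailure.blockPMF μ X Y n x y := fun n x y =>
    MeasureTheory.measureReal_nonneg
  have hP1 := DiskFailure.sum_blockPMF μ hX hY
  have hz : Filter.Tendsto (fun n : ℕ =>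
      Real.logb 2 (DiskFailure.renyiSum ρ (DiskFailure.blockPMF μ X Y n)) / n)
      Filter.atTop (nhds (ρ * H)) := by
    refine (hH.const_mul ρ).congr fun n => ?_
    rw [DiskFailure.logb_renyiSum hρ, mul_div_assoc]
  have hρH : 0 ≤ ρ * H := ge_of_tendsto' hz fun n => div_nonneg
    (Real.logb_nonneg one_lt_two (DiskFailure.one_le_renyiSum hρ (hP n) (hP1 n))) (Nat.cast_nonneg n)
  have hH0 : 0 ≤ H := nonneg_of_mul_nonneg_right hρH hρ
  refine ⟨fun h => ?_, fun h => ?_, fun EB hEB => ⟨fun h hv => ?_, fun h => ?_⟩⟩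
  -- Since `H ≥ 0`, the strict inequality excludes rate zero, so here the list version needs no
  -- separate assumption.
  · have hRs0 : 0 < Rs := by
      rcases hRs.eq_or_lt with h0 | h0
      · rw [← h0, mul_zero] at h
        linarith
      · exact h0
    refine le_antisymm (iSup_le fun E => EReal.coe_le_coe_iff.mpr ?_) ?_
    · obtain ⟨h1, h2, -⟩ := E.2.isModestAchievable.bounds hρ hνδ hην.le hP hP1 hz hRs
      rw [mul_min_of_nonneg _ _ hρ.le]
      exact le_min (by linarith) h1
    -- The exponent is achieved only up to the slack `ε`; the supremum reaches it as `ε` decreases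
    -- to `0`.
    · have hlim : Filter.Tendsto (fun ε : ℝ =>
          ((ρ * min (Rs * ((ν : ℝ) - η) - ε) H : ℝ) : EReal)) (nhdsWithin 0 (Set.Ioi 0))
          (nhds ((ρ * min (Rs * ((ν : ℝ) - η)) H : ℝ) : EReal)) := by
        refine EReal.tendsto_coe.mpr (Filter.Tendsto.mono_left ?_ nhdsWithin_le_nhds)
        have hc : Continuous fun ε : ℝ => ρ * min (Rs * ((ν : ℝ) - η) - ε) H := by fun_prop
        simpa using hc.tendsto 0
      refine le_of_tendsto hlim ?_
      filter_upwards [Ioo_mem_nhdsGT (sub_pos.mpr h)] with ε hε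
      exact le_iSup (fun E : {E : ℝ // DiskFailure.IsAchievable v ρ δ ν η Rs
        (DiskFailure.blockPMF μ X Y) E} => ((E : ℝ) : EReal))
        ⟨_, DiskFailure.isAchievable_of_lt hρ hνδ hην hP hP1 hz hRs0 v hε.1 hε.2.le⟩
  · refine iSup_eq_bot.mpr fun E => ?_
    obtain ⟨-, -, h3⟩ := E.2.isModestAchievable.bounds hρ hνδ hην.le hP hP1 hz hRs
    nlinarith
  · refine le_antisymm (iSup_le fun E => EReal.coe_le_coe_iff.mpr ?_) ?_
    · obtain ⟨h1, h2, -⟩ := E.2.bounds hρ hνδ hην.le hP hP1 hz hRs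
      exact le_min h2 h1
    · have hach : DiskFailure.IsModestAchievable v ρ δ ν η Rs (DiskFailure.blockPMF μ X Y) EB
          (min (ρ * Rs * ((ν : ℝ) - η) + EB) (ρ * H)) := by
        rcases hRs.eq_or_lt with h0 | h0
        · subst h0
          cases v
          · have hle : ρ * H ≤ EB := by
              have h1 := mul_le_mul_of_nonneg_left h hρ.le
              rw [mul_sub, mul_inv_cancel_left₀ hρ.ne', mul_zero, mul_zero] at h1
              linarith
            have hmin : min (ρ * 0 * ((ν : ℝ) - η) + EB) (ρ * H) = ρ * H := by
              rw [mul_zero, zero_mul, zero_add, min_eq_right hle]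
            rw [hmin]
            exact DiskFailure.isModestAchievable_of_eq_zero hρ hνδ hην hP hP1 hz hle
          · exact absurd (hv rfl) (lt_irrefl 0)
        · exact DiskFailure.isModestAchievable_of_pos hρ hνδ hην hP hP1 hz h0 v hEB h
      exact le_iSup (fun E : {E : ℝ // DiskFailure.IsModestAchievable v ρ δ ν η Rs
        (DiskFailure.blockPMF μ X Y) EB E} => ((E : ℝ) : EReal)) ⟨_, hach⟩
  · refine iSup_eq_bot.mpr fun E => ?_
    obtain ⟨-, -, h3⟩ := E.2.bounds hρ hνδ hην.le hP hP1 hz hRs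
    have h1 := mul_lt_mul_of_pos_left h hρ
    rw [mul_sub, mul_inv_cancel_left₀ hρ.ne'] at h1
    linarith
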